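/- **Setting.** Let $\mathscr V$ be a closed symmetric monoidal category with a model structure satisfying the usual compatibility axiom of a symmetric monoidal model category: the pushout-product of two cofibrations $i,j$ has the left lifting property with respect to every fibration $p$ whenever at least one of $i,j,p$ is a weak equivalence. For an algebra (monoid) $A$ in $\mathscr V$ let $\mathscr V_A$ be the category of right $A$-modules. An $A$-*coring* $C$ is a comonoid, with comultiplication $\Delta$ and counit $\epsilon$, in the monoidal category of $A$-$A$-bimodules under $\otimes_A$; let $\mathscr V_A^C$ be the category of right $C$-comodules, i.e. right $A$-modules $M$ with a coassociative and counital coaction $\delta\colon M\to M\otimes_A C$. Assume that for every algebra $A$ a model structure on $\mathscr V_A$ is given and that for every coring $(A,C)$ the category $\mathscr V_A^C$ has the model structure left-induced from that of $\mathscr V_A$: a morphism of comodules is a weak equivalence (respectively a cofibration) if and only if it is one in $\mathscr V_A$. **Braided bimodules.** A *braided bimodule* $(X,T)\colon(A,C)\to(B,D)$ consists of an $A$-$B$-bimodule $X$ and a morphism of $A$-$B$-bimodules $T\colon C\otimes_A X\to X\otimes_B D$ such that, up to associativity and unit isomorphisms, $(1_X\otimes\Delta_D)T=(T\otimes 1_D)(1_C\otimes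 T)(\Delta_C\otimes 1_X)$ and $(1_X\otimes\epsilon_D)T=\epsilon_C\otimes 1_X$. It induces the functor $T_*\colon\mathscr V_A^C\to\mathscr V_B^D$ sending $(M,\delta)$ to $M\otimes_A X$ with coaction $(1_M\otimes T)(\delta\otimes 1_X)$. The right adjoint of $T_*$ (which exists under the assumptions below) is denoted $T^*$. The bimodule $X$ is *strictly (right) dualizable* if there are a $B$-$A$-bimodule $X^\vee$ and bimodule maps $u\colon A\to X\otimes_B X^\vee$, $e\colon X^\vee\otimes_A X\to B$ satisfying the two triangle identities. In that case: * the *canonical coring* is the $B$-coring $X_*(C)=X^\vee\otimes_A C\otimes_A X$, whose comultiplication applies $\Delta_C$ and then inserts $u$ between the two copies of $C$, and whose counit is $e\,(1\otimes\epsilon_C\otimes 1)$; $(X,T^{\mathrm{univ}})\colon(A,C)\to(B,X_*(C))$ with $T^{\mathrm{univ}}=u\otimes 1_{C\otimes_A X}$ is a braided bimodule, and the adjunction $\mathscr V_A^C\rightleftarrows\mathscr V_B^{X_*(C)}$ that it governs is denoted $\operatorname{Can}_X\dashv\operatorname{Prim}_X$; * $X$ *satisfies effective homotopic descent with respect to $C$*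 if $\operatorname{Can}_X\dashv\operatorname{Prim}_X$ is a Quillen equivalence; * $g_T\colon X_*(C)\to D$ is the morphism of $B$-corings $(e\otimes 1_D)(1_{X^\vee}\otimes T)$. A morphism $f\colon C'\to D$ of $B$-corings induces $f_*\colon\mathscr V_B^{C'}\to\mathscr V_B^{D}$, $(M,\delta)\mapsto(M,(1_M\otimes f)\delta)$, with right adjoint $f^*$. It is a *copure weak equivalence* if $f$ is a weak equivalence in $\mathscr V_B$ and the counit $f_*f^*M\to M$ is a weak equivalence for every fibrant $M$ in $\mathscr V_B^{D}$. The coring $(A,C)$ is *flat* if $-\otimes_A C\colon\mathscr V_A\to\mathscr V$ preserves coreflexive equalizers. The left $A$-module $X$ is *strongly homotopy flat* if $-\otimes_A X\colon\mathscr V_A\to\mathscr V$ preserves weak equivalences and, for every finite category $J$ and every functor $\Phi\colon J\to\mathscr V_A$, the natural map $(\lim_J\Phi)\otimes_A X\to\lim_J(\Phi\otimes_A X)$ is a weak equivalence in $\mathscr V$. **Theorem (homotopical Morita–Takeuchi theorem).** Let $(X,T)\colon(A,C)\to(B,D)$ be a braided bimodule such that $X$ is strictly right dualizable and $-\otimes_A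 X\colon\mathscr V_A\to\mathscr V_B$ is a left Quillen functor. 1. If $X$ satisfies effective homotopic descent with respect to $C$ and $g_T\colon X_*(C)\to D$ is a copure weak equivalence of corings, then $T_*\dashv T^*$ is a Quillen equivalence between $\mathscr V_A^C$ and $\mathscr V_B^D$. 2. Conversely, suppose that every morphism of $\mathscr V_B$ that is a weak equivalence in $\mathscr V$ is a weak equivalence in $\mathscr V_B$, that $B$ is fibrant in $\mathscr V_B$, that the coring $(A,C)$ is flat and that the left $A$-module $X$ is strongly homotopy flat. If $T_*\dashv T^*$ is a Quillen equivalence, then $X$ satisfies effective homotopic descent with respect to $C$ and $g_T\colon X_*(C)\to D$ is a copure weak equivalence of corings. -/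

import Mathlib

universe v u

open CategoryTheory Limits HomotopicalAlgebra

namespace MoritaTakeuchi

/-! ### Corings, comodules and braided bimodules in a bicategory -/

section Bicat

open Bicategory

universe w v₁ u₁

variable {𝓑 : Type u₁} [Bicategory.{w, v₁} 𝓑] {a b : 𝓑}

/-- The comonad `M ↦ M ≫ C` on the category of 1-morphisms `k ⟶ a` induced by a comonoid `C` of the
monoidal category of endomorphisms of `a`. In the bicategory of algebras and bimodules, with `k` the
unit algebra, this is the comonad `- ⊗_A C` on right `A`-modules. -/
def comoduleComonad (k : 𝓑) (C : Comon (a ⟶ a)) : CategoryTheory.Comonad (k ⟶ a) :=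
  CategoryTheory.Comonad.mk (postcomp k C.X)
    { app := fun M => M ◁ ε[C.X] ≫ (ρ_ M).hom
      naturality := by intros; simp [postcomp, ← whisker_exchange_assoc] }
    { app := fun M => M ◁ Δ[C.X] ≫ (α_ M C.X C.X).inv
      naturality := by intros; simp [postcomp, ← whisker_exchange_assoc] }
    (by
      intro M
      dsimp [postcomp]
      have h := congrArg (fun t => M ◁ t) (Comonad.comul_assoc C.X)
      simp only [Bicategory.whiskerLeft_comp] at h
      simp only [Category.assoc, comp_whiskerRight]
      have e : (α_ M C.X C.X).inv ≫ (M ≫ C.X) ◁ Δ[C.X] ≫ (α_ (M ≫ C.X) C.X C.X).inv =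
        M ◁ C.X ◁ Δ[C.X] ≫ M ◁ (α_ C.X C.X C.X).inv ≫ (α_ M (C.X ≫ C.X) C.X).inv ≫
          (α_ M C.X C.X).inv ▷ C.X := by bicategory
      rw [e, reassoc_of% h]
      bicategory)
    (by
      intro M
      dsimp [postcomp]
      have h := congrArg (fun t => M ◁ t) (Comonad.comul_counit C.X)
      simp only [Bicategory.whiskerLeft_comp] at h
      simp [reassoc_of% h])
    (by
      intro M
      dsimp [postcomp]
      have h := congrArg (fun t => M ◁ t) (Comonad.counit_comul C.X)
      simp only [Bicategory.whiskerLeft_comp] at h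
      simp [reassoc_of% h])

/-- Right comodules over `C`: a 1-morphism `M : k ⟶ a` with a counital and coassociative coaction
`M ⟶ M ≫ C` (see `Comodule.coact` and the three lemmas below it). -/
abbrev Comodule (k : 𝓑) (C : Comon (a ⟶ a)) := (comoduleComonad k C).Coalgebra

section
variable {k : 𝓑} {C : Comon (a ⟶ a)} (M : Comodule k C)

/-- The coaction of a comodule. -/
def Comodule.coact : M.A ⟶ M.A ≫ C.X := M.a

theorem Comodule.coact_counit : M.coact ≫ M.A ◁ ε[C.X] ≫ (ρ_ M.A).hom = 𝟙 M.A := M.counit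

theorem Comodule.coact_coassoc :
    M.coact ≫ M.A ◁ Δ[C.X] ≫ (α_ M.A C.X C.X).inv = M.coact ≫ M.coact ▷ C.X := M.coassoc

theorem Comodule.hom_coact {M N : Comodule k C} (f : M ⟶ N) :
    M.coact ≫ f.f ▷ C.X = f.f ≫ N.coact := f.h

/-- Constructor of comodules with the axioms spelled out. -/
def Comodule.mk' (A : k ⟶ a) (coact : A ⟶ A ≫ C.X)
    (counit : coact ≫ A ◁ ε[C.X] ≫ (ρ_ A).hom = 𝟙 A)
    (coassoc : coact ≫ A ◁ Δ[C.X] ≫ (α_ A C.X C.X).inv = coact ≫ coact ▷ C.X) : Comodule k C where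
  A := A
  a := coact
  counit := counit
  coassoc := coassoc

end

/-- Braided bimodules `(X, T)`: a 1-morphism `X` and a 2-morphism `T : C ≫ X ⟶ X ≫ D` subject to the
pentagon and counit axioms. -/
structure BraidedBimodule (C : Comon (a ⟶ a)) (D : Comon (b ⟶ b)) where
  X : a ⟶ b
  T : C.X ≫ X ⟶ X ≫ D.X
  pentagon : T ≫ X ◁ Δ[D.X] =
    Δ[C.X] ▷ X ≫ (α_ C.X C.X X).hom ≫ C.X ◁ T ≫ (α_ C.X X D.X).inv ≫ T ▷ D.X ≫
      (α_ X D.X D.X).hom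
  counit : T ≫ X ◁ ε[D.X] ≫ (ρ_ X).hom = ε[C.X] ▷ X ≫ (λ_ X).hom

variable {C : Comon (a ⟶ a)} {D : Comon (b ⟶ b)}

/-- The functor `T_*`, sending `(M, δ)` to `M ≫ X` with the coaction `δ ▷ X` followed by `M ◁ T`. -/
def BraidedBimodule.lowerStar (k : 𝓑) (P : BraidedBimodule C D) : Comodule k C ⥤ Comodule k D where
  obj M := Comodule.mk' (M.A ≫ P.X)
      (M.coact ▷ P.X ≫ (α_ M.A C.X P.X).hom ≫ M.A ◁ P.T ≫ (α_ M.A P.X D.X).inv)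
      (by
        have h := congrArg (fun t => M.A ◁ t) P.counit
        have h2 := congrArg (fun t => t ▷ P.X) M.coact_counit
        simp only [Bicategory.whiskerLeft_comp, comp_whiskerRight, id_whiskerRight] at h h2
        rw [← h2]
        have e : (α_ M.A P.X D.X).inv ≫ (M.A ≫ P.X) ◁ ε[D.X] ≫ (ρ_ (M.A ≫ P.X)).hom =
            M.A ◁ P.X ◁ ε[D.X] ≫ M.A ◁ (ρ_ P.X).hom := by bicategory
        simp only [Category.assoc]
        rw [e, h]
        bicategory)
      (by
        have h := congrArg (fun t => M.A ◁ t) P.pentagon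
        have h2 := congrArg (fun t => t ▷ P.X) M.coact_coassoc
        simp only [Bicategory.whiskerLeft_comp, comp_whiskerRight] at h h2
        have e : (α_ M.A P.X D.X).inv ≫ (M.A ≫ P.X) ◁ Δ[D.X] ≫ (α_ (M.A ≫ P.X) D.X D.X).inv =
          M.A ◁ P.X ◁ Δ[D.X] ≫ M.A ◁ (α_ P.X D.X D.X).inv ≫ (α_ M.A (P.X ≫ D.X) D.X).inv ≫
            (α_ M.A P.X D.X).inv ▷ D.X := by bicategory
        simp only [Category.assoc, comp_whiskerRight]
        rw [e, reassoc_of% h]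
        have e2 : M.coact ▷ P.X ≫ (α_ M.A C.X P.X).hom ≫ M.A ◁ P.T ≫ (α_ M.A P.X D.X).inv ≫
          M.coact ▷ P.X ▷ D.X = (M.coact ▷ P.X ≫ M.coact ▷ C.X ▷ P.X) ≫ (α_ (M.A ≫ C.X) C.X P.X).hom ≫
            (M.A ≫ C.X) ◁ P.T ≫ (α_ (M.A ≫ C.X) P.X D.X).inv := by
          have : M.coact ▷ P.X ▷ D.X = (α_ M.A P.X D.X).hom ≫ M.coact ▷ (P.X ≫ D.X) ≫ (α_ (M.A ≫ C.X) P.X D.X).inv := by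
            bicategory
          rw [this]
          simp only [Category.assoc, Iso.inv_hom_id_assoc, whisker_exchange_assoc]
          bicategory
        rw [reassoc_of% e2, ← reassoc_of% h2]
        bicategory)
  map {M N} f :=
    { f := f.f ▷ P.X
      h := by
        have h := congrArg (fun t => t ▷ P.X) (Comodule.hom_coact f)
        simp only [comp_whiskerRight] at h
        change (M.coact ▷ P.X ≫ (α_ M.A C.X P.X).hom ≫ M.A ◁ P.T ≫ (α_ M.A P.X D.X).inv) ≫ f.f ▷ P.X ▷ D.X = f.f ▷ P.X ≫ N.coact ▷ P.X ≫ (α_ N.A C.X P.X).hom ≫ N.A ◁ P.T ≫ (α_ N.A P.X D.X).inv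
        rw [← reassoc_of% h]
        have : f.f ▷ P.X ▷ D.X = (α_ M.A P.X D.X).hom ≫ f.f ▷ (P.X ≫ D.X) ≫ (α_ N.A P.X D.X).inv := by
            bicategory
        rw [this]
        simp only [Category.assoc, Iso.inv_hom_id_assoc, whisker_exchange_assoc]
        bicategory }
  map_id M := by ext; exact id_whiskerRight _ _
  map_comp f g := by ext; exact comp_whiskerRight _ _ _

/-- The change-of-corings functor `f_*`, sending `(M, δ)` to `M` with the coaction `δ ≫ M ◁ f`. -/
def changeOfCorings (k : 𝓑) {C D : Comon (a ⟶ a)} (f : C ⟶ D) : Comodule k C ⥤ Comodule k D where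
  obj M := Comodule.mk' M.A (M.coact ≫ M.A ◁ f.hom)
      (by
        have h := congrArg (fun t => M.A ◁ t) (IsComonHom.hom_counit f.hom)
        simp only [Bicategory.whiskerLeft_comp] at h
        simp only [Category.assoc]
        refine Eq.trans ?_ M.coact_counit
        erw [reassoc_of% h])
      (by
        have h := congrArg (fun t => M.A ◁ t) (IsComonHom.hom_comul f.hom)
        simp only [Bicategory.whiskerLeft_comp] at h
        simp only [Category.assoc, comp_whiskerRight]
        have h' : M.A ◁ f.hom ≫ M.A ◁ Δ[D.X] =
            M.A ◁ Δ[C.X] ≫ M.A ◁ (f.hom ▷ C.X ≫ D.X ◁ f.hom) := h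
        have e : M.A ◁ (f.hom ▷ C.X ≫ D.X ◁ f.hom) ≫ (α_ M.A D.X D.X).inv =
            (α_ M.A C.X C.X).inv ≫ (M.A ◁ f.hom) ▷ C.X ≫ (M.A ≫ D.X) ◁ f.hom := by bicategory
        have h2 := M.coact_coassoc
        rw [reassoc_of% h', e, reassoc_of% h2, whisker_exchange_assoc, whisker_exchange])
  map {M N} φ :=
    { f := φ.f
      h := by
        have h := Comodule.hom_coact φ
        change (M.coact ≫ M.A ◁ f.hom) ≫ φ.f ▷ D.X = φ.f ≫ N.coact ≫ N.A ◁ f.hom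
        rw [← reassoc_of% h, Category.assoc, whisker_exchange] }

/-- The adjunction `- ≫ X ⊣ - ≫ Xd` between categories of 1-morphisms out of `k` induced by a dual
pair `X ⊣ Xd`. -/
def postcompAdjunction (k : 𝓑) {X : a ⟶ b} {Xd : b ⟶ a} (adj : Bicategory.Adjunction X Xd) :
    CategoryTheory.Adjunction (postcomp k X) (postcomp k Xd) :=
  CategoryTheory.Adjunction.mkOfUnitCounit
    { unit :=
        { app := fun M => (ρ_ M).inv ≫ M ◁ adj.unit ≫ (α_ M X Xd).inv
          naturality := by
            intro M N f
            dsimp [postcomp]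
            have e : f ▷ X ▷ Xd = (α_ M X Xd).hom ≫ f ▷ (X ≫ Xd) ≫ (α_ N X Xd).inv := by
              bicategory
            rw [e]
            simp only [Category.assoc, Iso.inv_hom_id_assoc, whisker_exchange_assoc]
            bicategory }
      counit :=
        { app := fun M => (α_ M Xd X).hom ≫ M ◁ adj.counit ≫ (ρ_ M).hom
          naturality := by
            intro M N f
            dsimp [postcomp]
            have e : f ▷ Xd ▷ X = (α_ M Xd X).hom ≫ f ▷ (Xd ≫ X) ≫ (α_ N Xd X).inv := by
              bicategory
            rw [e]
            simp only [Category.assoc, Iso.inv_hom_id_assoc, ← whisker_exchange_assoc]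
            bicategory }
      left_triangle := by
        ext M
        dsimp [postcomp]
        calc
          _ = 𝟙 _ ⊗≫ M ◁ leftZigzag adj.unit adj.counit ⊗≫ 𝟙 _ := by bicategory
          _ = _ := by rw [adj.left_triangle]; bicategory
      right_triangle := by
        ext M
        dsimp [postcomp]
        calc
          _ = 𝟙 _ ⊗≫ M ◁ rightZigzag adj.unit adj.counit ⊗≫ 𝟙 _ := by bicategory
          _ = _ := by rw [adj.right_triangle]; bicategory }

theorem isLeftAdjoint_lowerStar (k : 𝓑) (P : BraidedBimodule C D) {Xd : b ⟶ a}
    (adj : Bicategory.Adjunction P.X Xd) [HasCoreflexiveEqualizers (Comodule k C)] :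
    (P.lowerStar k).IsLeftAdjoint :=
  have : (postcomp k P.X).IsLeftAdjoint := (postcompAdjunction k adj).isLeftAdjoint
  isLeftAdjoint_square_lift_comonadic (P.lowerStar k) (comoduleComonad k D).forget
    (comoduleComonad k C).forget (postcomp k P.X) (Iso.refl _)

theorem isLeftAdjoint_changeOfCorings (k : 𝓑) {C D : Comon (a ⟶ a)} (f : C ⟶ D)
    [HasCoreflexiveEqualizers (Comodule k C)] : (changeOfCorings k f).IsLeftAdjoint :=
  isLeftAdjoint_square_lift_comonadic (changeOfCorings k f) (comoduleComonad k D).forget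
    (comoduleComonad k C).forget (𝟭 _) (Iso.refl _)

/-- The functor `T^*`: the right adjoint of `T_*`, for a braided bimodule `(X, T)` whose underlying
1-morphism `X` has a right dual. -/
noncomputable def BraidedBimodule.upperStar (k : 𝓑) (P : BraidedBimodule C D) {Xd : b ⟶ a}
    (adj : Bicategory.Adjunction P.X Xd) [HasCoreflexiveEqualizers (Comodule k C)] :
    Comodule k D ⥤ Comodule k C :=
  have := isLeftAdjoint_lowerStar k P adj
  (P.lowerStar k).rightAdjoint

/-- The adjunction `T_* ⊣ T^*` governed by a braided bimodule. -/
noncomputable def BraidedBimodule.starAdjunction (k : 𝓑) (P : BraidedBimodule C D) {Xd : b ⟶ a}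
    (adj : Bicategory.Adjunction P.X Xd) [HasCoreflexiveEqualizers (Comodule k C)] :
    CategoryTheory.Adjunction (P.lowerStar k) (P.upperStar k adj) :=
  have := isLeftAdjoint_lowerStar k P adj
  CategoryTheory.Adjunction.ofIsLeftAdjoint (P.lowerStar k)

/-- The functor `f^*`: the right adjoint of the change-of-corings functor `f_*`. -/
noncomputable def corestriction (k : 𝓑) {C D : Comon (a ⟶ a)} (f : C ⟶ D)
    [HasCoreflexiveEqualizers (Comodule k C)] : Comodule k D ⥤ Comodule k C :=
  have := isLeftAdjoint_changeOfCorings k f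
  (changeOfCorings k f).rightAdjoint

/-- The change-of-corings adjunction `f_* ⊣ f^*`. -/
noncomputable def changeOfCoringsAdjunction (k : 𝓑) {C D : Comon (a ⟶ a)} (f : C ⟶ D)
    [HasCoreflexiveEqualizers (Comodule k C)] :
    CategoryTheory.Adjunction (changeOfCorings k f) (corestriction k f) :=
  have := isLeftAdjoint_changeOfCorings k f
  CategoryTheory.Adjunction.ofIsLeftAdjoint (changeOfCorings k f)

variable (C) {X : a ⟶ b} {Xd : b ⟶ a} (adj : Bicategory.Adjunction X Xd)

/-- The counit of the canonical coring: apply the counit of `C`, then evaluate. -/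
def canonicalCounit : Xd ≫ C.X ≫ X ⟶ 𝟙 b :=
  Xd ◁ ε[C.X] ▷ X ⊗≫ adj.counit

/-- The comultiplication of the canonical coring: comultiply in `C`, then insert the coevaluation. -/
def canonicalComul : Xd ≫ C.X ≫ X ⟶ (Xd ≫ C.X ≫ X) ≫ Xd ≫ C.X ≫ X :=
  Xd ◁ Δ[C.X] ▷ X ⊗≫ Xd ◁ C.X ◁ adj.unit ▷ (C.X ≫ X) ⊗≫ 𝟙 ((Xd ≫ C.X ≫ X) ≫ Xd ≫ C.X ≫ X)

theorem canonical_counit_comul :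
    canonicalComul C adj ≫ canonicalCounit C adj ▷ (Xd ≫ C.X ≫ X) =
      (λ_ (Xd ≫ C.X ≫ X)).inv := by
  dsimp only [canonicalComul, canonicalCounit]
  calc
    _ = Xd ◁ Δ[C.X] ▷ X ⊗≫ Xd ◁ (C.X ◁ adj.unit ≫ ε[C.X] ▷ (X ≫ Xd)) ▷ (C.X ≫ X) ⊗≫
        adj.counit ▷ (Xd ≫ C.X ≫ X) := by bicategory
    _ = Xd ◁ (Δ[C.X] ≫ ε[C.X] ▷ C.X) ▷ X ⊗≫
        rightZigzag adj.unit adj.counit ▷ (C.X ≫ X) ⊗≫ 𝟙 _ := by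
      rw [whisker_exchange]; bicategory
    _ = _ := by
      rw [adj.right_triangle, Comonad.counit_comul]; bicategory

theorem canonical_comul_counit :
    canonicalComul C adj ≫ (Xd ≫ C.X ≫ X) ◁ canonicalCounit C adj =
      (ρ_ (Xd ≫ C.X ≫ X)).inv := by
  dsimp only [canonicalComul, canonicalCounit]
  calc
    _ = Xd ◁ Δ[C.X] ▷ X ⊗≫ (Xd ≫ C.X) ◁ (adj.unit ▷ C.X ≫ (X ≫ Xd) ◁ ε[C.X]) ▷ X ⊗≫
        (Xd ≫ C.X ≫ X) ◁ adj.counit := by bicategory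
    _ = Xd ◁ (Δ[C.X] ≫ C.X ◁ ε[C.X]) ▷ X ⊗≫
        (Xd ≫ C.X) ◁ leftZigzag adj.unit adj.counit ⊗≫ 𝟙 _ := by
      rw [← whisker_exchange]; bicategory
    _ = _ := by
      rw [adj.left_triangle, Comonad.comul_counit]; bicategory

theorem canonical_comul_assoc :
    canonicalComul C adj ≫ (Xd ≫ C.X ≫ X) ◁ canonicalComul C adj =
      canonicalComul C adj ≫ canonicalComul C adj ▷ (Xd ≫ C.X ≫ X) ≫
        (α_ (Xd ≫ C.X ≫ X) (Xd ≫ C.X ≫ X) (Xd ≫ C.X ≫ X)).hom := by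
  dsimp only [canonicalComul]
  calc
    _ = Xd ◁ Δ[C.X] ▷ X ⊗≫ (Xd ≫ C.X) ◁ (adj.unit ▷ C.X ≫ (X ≫ Xd) ◁ Δ[C.X]) ▷ X ⊗≫
        (Xd ≫ C.X ≫ X ≫ Xd ≫ C.X) ◁ adj.unit ▷ (C.X ≫ X) ⊗≫ 𝟙 _ := by bicategory
    _ = Xd ◁ (Δ[C.X] ≫ C.X ◁ Δ[C.X]) ▷ X ⊗≫ (Xd ≫ C.X) ◁ (adj.unit ▷ (C.X ≫ 𝟙 a) ≫
        (X ≫ Xd) ◁ (C.X ◁ adj.unit)) ▷ (C.X ≫ X) ⊗≫ 𝟙 _ := by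
      rw [← whisker_exchange]; bicategory
    _ = Xd ◁ (Δ[C.X] ≫ Δ[C.X] ▷ C.X ≫ (α_ C.X C.X C.X).hom) ▷ X ⊗≫
        (Xd ≫ C.X) ◁ (𝟙 a ◁ (C.X ◁ adj.unit) ≫ adj.unit ▷ (C.X ≫ X ≫ Xd)) ▷ (C.X ≫ X) ⊗≫
        𝟙 _ := by
      rw [← whisker_exchange, Comonad.comul_assoc]
    _ = Xd ◁ Δ[C.X] ▷ X ⊗≫ Xd ◁ (Δ[C.X] ▷ 𝟙 a ≫ (C.X ≫ C.X) ◁ adj.unit) ▷ (C.X ≫ X) ⊗≫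
        (Xd ≫ C.X) ◁ adj.unit ▷ (C.X ≫ X ≫ Xd ≫ C.X ≫ X) ⊗≫ 𝟙 _ := by bicategory
    _ = _ := by
      rw [← whisker_exchange]; bicategory

/-- The canonical coring `X_*(C) = Xd ≫ C ≫ X` attached to a 1-morphism `X` with right dual `Xd`. -/
def canonicalCoring : Comon (b ⟶ b) where
  X := Xd ≫ C.X ≫ X
  comon :=
    { counit := canonicalCounit C adj
      comul := canonicalComul C adj
      counit_comul := canonical_counit_comul C adj
      comul_counit := canonical_comul_counit C adj
      comul_assoc := canonical_comul_assoc C adj }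

/-- The universal braided bimodule `(X, T^univ) : (a, C) → (b, X_*(C))`, where
`T^univ : C ≫ X ⟶ X ≫ Xd ≫ C ≫ X` inserts the coevaluation. -/
def universalBraiding : BraidedBimodule C (canonicalCoring C adj) where
  X := X
  T := (λ_ (C.X ≫ X)).inv ≫ adj.unit ▷ (C.X ≫ X) ≫ (α_ X Xd (C.X ≫ X)).hom
  pentagon := by
    change ((λ_ (C.X ≫ X)).inv ≫ adj.unit ▷ (C.X ≫ X) ≫ (α_ X Xd (C.X ≫ X)).hom) ≫
      X ◁ canonicalComul C adj = Δ[C.X] ▷ X ≫ (α_ C.X C.X X).hom ≫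
        C.X ◁ ((λ_ (C.X ≫ X)).inv ≫ adj.unit ▷ (C.X ≫ X) ≫ (α_ X Xd (C.X ≫ X)).hom) ≫
        (α_ C.X X (Xd ≫ C.X ≫ X)).inv ≫
        ((λ_ (C.X ≫ X)).inv ≫ adj.unit ▷ (C.X ≫ X) ≫ (α_ X Xd (C.X ≫ X)).hom) ▷
          (Xd ≫ C.X ≫ X) ≫ (α_ X (Xd ≫ C.X ≫ X) (Xd ≫ C.X ≫ X)).hom
    dsimp only [canonicalComul]
    calc
      _ = 𝟙 _ ⊗≫ (adj.unit ▷ C.X ≫ (X ≫ Xd) ◁ Δ[C.X]) ▷ X ⊗≫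
          (X ≫ Xd ≫ C.X) ◁ adj.unit ▷ (C.X ≫ X) ⊗≫ 𝟙 _ := by bicategory
      _ = Δ[C.X] ▷ X ⊗≫ (adj.unit ▷ (C.X ≫ 𝟙 a) ≫ (X ≫ Xd) ◁ (C.X ◁ adj.unit)) ▷ (C.X ≫ X) ⊗≫
          𝟙 _ := by
        rw [← whisker_exchange]; bicategory
      _ = _ := by
        rw [← whisker_exchange]; bicategory
  counit := by
    change ((λ_ (C.X ≫ X)).inv ≫ adj.unit ▷ (C.X ≫ X) ≫ (α_ X Xd (C.X ≫ X)).hom) ≫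
      X ◁ canonicalCounit C adj ≫ (ρ_ X).hom = ε[C.X] ▷ X ≫ (λ_ X).hom
    dsimp only [canonicalCounit]
    calc
      _ = 𝟙 _ ⊗≫ (adj.unit ▷ C.X ≫ (X ≫ Xd) ◁ ε[C.X]) ▷ X ⊗≫ X ◁ adj.counit ⊗≫ 𝟙 _ := by
        bicategory
      _ = ε[C.X] ▷ X ⊗≫ leftZigzag adj.unit adj.counit ⊗≫ 𝟙 _ := by
        rw [← whisker_exchange]; bicategory
      _ = _ := by
        rw [adj.left_triangle]; bicategory

variable {C}

/-- The 2-morphism underlying `g_T`: apply `T`, then evaluate. -/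
def canonicalMapHom (P : BraidedBimodule C D) {Xd : b ⟶ a} (adj : Bicategory.Adjunction P.X Xd) :
    Xd ≫ C.X ≫ P.X ⟶ D.X :=
  Xd ◁ P.T ⊗≫ adj.counit ▷ D.X ⊗≫ 𝟙 D.X

theorem canonicalMapHom_counit (P : BraidedBimodule C D) {Xd : b ⟶ a} (adj : Bicategory.Adjunction P.X Xd) :
    canonicalMapHom P adj ≫ ε[D.X] = canonicalCounit C adj := by
  dsimp only [canonicalMapHom, canonicalCounit]
  calc
    _ = Xd ◁ P.T ⊗≫ (adj.counit ▷ D.X ≫ 𝟙 b ◁ ε[D.X]) ⊗≫ 𝟙 _ := by bicategory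
    _ = Xd ◁ (P.T ≫ P.X ◁ ε[D.X] ≫ (ρ_ P.X).hom) ⊗≫ adj.counit := by
      rw [← whisker_exchange]; bicategory
    _ = _ := by
      rw [P.counit]; bicategory

theorem canonicalMapHom_comul (P : BraidedBimodule C D) {Xd : b ⟶ a} (adj : Bicategory.Adjunction P.X Xd) :
    canonicalMapHom P adj ≫ Δ[D.X] = canonicalComul C adj ≫
      canonicalMapHom P adj ▷ (Xd ≫ C.X ≫ P.X) ≫ D.X ◁ canonicalMapHom P adj := by
  dsimp only [canonicalMapHom, canonicalComul]
  symm
  calc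
    _ = Xd ◁ Δ[C.X] ▷ P.X ⊗≫ (Xd ≫ C.X) ◁ adj.unit ▷ (C.X ≫ P.X) ⊗≫
        Xd ◁ P.T ▷ (Xd ≫ C.X ≫ P.X) ⊗≫
        (adj.counit ▷ (D.X ≫ Xd ≫ C.X ≫ P.X) ≫ 𝟙 b ◁ (D.X ◁ Xd ◁ P.T)) ⊗≫
        D.X ◁ adj.counit ▷ D.X ⊗≫ 𝟙 _ := by bicategory
    _ = Xd ◁ Δ[C.X] ▷ P.X ⊗≫ (Xd ≫ C.X) ◁ adj.unit ▷ (C.X ≫ P.X) ⊗≫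
        Xd ◁ (P.T ▷ (Xd ≫ C.X ≫ P.X) ≫ (P.X ≫ D.X) ◁ (Xd ◁ P.T)) ⊗≫
        adj.counit ▷ (D.X ≫ Xd ≫ P.X ≫ D.X) ⊗≫ D.X ◁ adj.counit ▷ D.X ⊗≫ 𝟙 _ := by
      rw [← whisker_exchange]; bicategory
    _ = Xd ◁ Δ[C.X] ▷ P.X ⊗≫
        (Xd ≫ C.X) ◁ (adj.unit ▷ (C.X ≫ P.X) ≫ (P.X ≫ Xd) ◁ P.T) ⊗≫
        Xd ◁ P.T ▷ (Xd ≫ P.X ≫ D.X) ⊗≫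
        adj.counit ▷ (D.X ≫ Xd ≫ P.X ≫ D.X) ⊗≫ D.X ◁ adj.counit ▷ D.X ⊗≫ 𝟙 _ := by
      rw [← whisker_exchange]; bicategory
    _ = Xd ◁ Δ[C.X] ▷ P.X ⊗≫ (Xd ≫ C.X) ◁ P.T ⊗≫
        (Xd ≫ C.X) ◁ adj.unit ▷ (P.X ≫ D.X) ⊗≫ Xd ◁ P.T ▷ (Xd ≫ P.X ≫ D.X) ⊗≫
        (adj.counit ▷ (D.X ≫ (Xd ≫ P.X) ≫ D.X) ≫ 𝟙 b ◁ (D.X ◁ adj.counit ▷ D.X)) ⊗≫ 𝟙 _ := by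
      rw [← whisker_exchange]; bicategory
    _ = Xd ◁ Δ[C.X] ▷ P.X ⊗≫ (Xd ≫ C.X) ◁ P.T ⊗≫
        (Xd ≫ C.X) ◁ adj.unit ▷ (P.X ≫ D.X) ⊗≫
        Xd ◁ (P.T ▷ ((Xd ≫ P.X) ≫ D.X) ≫ (P.X ≫ D.X) ◁ (adj.counit ▷ D.X)) ⊗≫
        adj.counit ▷ (D.X ≫ D.X) ⊗≫ 𝟙 _ := by
      rw [← whisker_exchange]; bicategory
    _ = Xd ◁ Δ[C.X] ▷ P.X ⊗≫ (Xd ≫ C.X) ◁ P.T ⊗≫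
        (Xd ≫ C.X) ◁ leftZigzag adj.unit adj.counit ▷ D.X ⊗≫ Xd ◁ P.T ▷ D.X ⊗≫
        adj.counit ▷ (D.X ≫ D.X) ⊗≫ 𝟙 _ := by
      rw [← whisker_exchange]; bicategory
    _ = Xd ◁ (Δ[C.X] ▷ P.X ≫ (α_ C.X C.X P.X).hom ≫ C.X ◁ P.T ≫ (α_ C.X P.X D.X).inv ≫
        P.T ▷ D.X ≫ (α_ P.X D.X D.X).hom) ⊗≫ adj.counit ▷ (D.X ≫ D.X) ⊗≫ 𝟙 _ := by
      rw [adj.left_triangle]; bicategory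
    _ = Xd ◁ P.T ⊗≫ ((Xd ≫ P.X) ◁ Δ[D.X] ≫ adj.counit ▷ (D.X ≫ D.X)) ⊗≫ 𝟙 _ := by
      rw [← P.pentagon]; bicategory
    _ = _ := by
      rw [whisker_exchange]; bicategory

/-- The morphism of corings `g_T : X_*(C) ⟶ D` attached to a braided bimodule `(X, T)`. -/
def canonicalMap (P : BraidedBimodule C D) {Xd : b ⟶ a} (adj : Bicategory.Adjunction P.X Xd) :
    canonicalCoring C adj ⟶ D where
  hom := canonicalMapHom P adj
  isComonHom_hom :=
    { hom_counit := canonicalMapHom_counit P adj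
      hom_comul := canonicalMapHom_comul P adj }

end Bicat

/-! ### Algebras and bimodules in a closed symmetric monoidal category -/

section Algebras

variable {V : Type u} [Category.{v} V] [MonoidalCategory V]

theorem trivial_actLeft {A : Mon V} (M : Bimod (Mon.trivial V) A) :
    M.actLeft = (MonoidalCategory.leftUnitor M.X).hom := by
  have h := M.one_actLeft
  exact (Category.id_comp _).symm.trans ((congrArg (fun t => t ≫ M.actLeft)
    (MonoidalCategory.id_whiskerRight (MonoidalCategory.tensorUnit V) M.X)).symm.trans h)

theorem unit_one_act (X : V) :
    MonoidalCategory.whiskerRight (𝟙 (MonoidalCategory.tensorUnit V)) X ≫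
      (MonoidalCategory.leftUnitor X).hom = (MonoidalCategory.leftUnitor X).hom := by
  simp

theorem unit_assoc (X : V) :
    MonoidalCategory.whiskerRight
        (MonoidalCategory.leftUnitor (MonoidalCategory.tensorUnit V)).hom X ≫
      (MonoidalCategory.leftUnitor X).hom =
    (MonoidalCategory.associator _ _ X).hom ≫
      MonoidalCategory.whiskerLeft _ (MonoidalCategory.leftUnitor X).hom ≫
        (MonoidalCategory.leftUnitor X).hom := by
  monoidal

theorem unit_middle_assoc {X B : V} (r : MonoidalCategory.tensorObj X B ⟶ X) :
    MonoidalCategory.whiskerRight (MonoidalCategory.leftUnitor X).hom B ≫ r =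
    (MonoidalCategory.associator (MonoidalCategory.tensorUnit V) X B).hom ≫
      MonoidalCategory.whiskerLeft _ r ≫ (MonoidalCategory.leftUnitor X).hom := by
  simp

/-- The right `B`-module underlying an `A`-`B`-bimodule, as a bimodule over the unit algebra and
`B`. -/
def restrictRightObj {A B : Mon V} (X : Bimod A B) : Bimod (Mon.trivial V) B where
  X := X.X
  actLeft := (MonoidalCategory.leftUnitor X.X).hom
  actRight := X.actRight
  one_actLeft := unit_one_act X.X
  left_assoc := unit_assoc X.X
  actRight_one := X.actRight_one
  right_assoc := X.right_assoc
  middle_assoc := unit_middle_assoc X.actRight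

/-- The map of right `B`-modules underlying a map of `A`-`B`-bimodules. -/
def restrictRightMap {A B : Mon V} {X Y : Bimod A B} (f : X ⟶ Y) :
    restrictRightObj X ⟶ restrictRightObj Y where
  hom := f.hom
  left_act_hom := (MonoidalCategory.leftUnitor_naturality f.hom).symm
  right_act_hom := f.right_act_hom

variable (V) in
/-- Algebras (monoids) in `V`, the objects of the bicategory of algebras and bimodules. -/
structure Alg where
  /-- the underlying monoid object -/
  toMon : Mon V

instance preservesColimits_tensorLeft [MonoidalClosed V] (X : V) :
    PreservesColimitsOfSize.{0, 0} (MonoidalCategory.tensorLeft X) :=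
  (ihom.adjunction X).leftAdjoint_preservesColimits

instance preservesColimits_tensorRight [MonoidalClosed V] [SymmetricCategory V] (X : V) :
    PreservesColimitsOfSize.{0, 0} (MonoidalCategory.tensorRight X) :=
  preservesColimits_of_natIso (BraidedCategory.tensorLeftIsoTensorRight X)

variable [SymmetricCategory V] [MonoidalClosed V] [HasCoequalizers V]

/-- The bicategory of algebras and bimodules in `V`: a 1-morphism `A ⟶ B` is an `A`-`B`-bimodule, a
2-morphism is a map of bimodules, and the composite `X ≫ Y` is `X ⊗_B Y`. -/
noncomputable instance : Bicategory (Alg V) where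
  Hom A B := Bimod A.toMon B.toMon
  homCategory A B := (inferInstance : Category (Bimod A.toMon B.toMon))
  id A := Bimod.regular A.toMon
  comp M N := Bimod.tensorBimod M N
  whiskerLeft L _ _ f := Bimod.whiskerLeft L f
  whiskerRight f N := Bimod.whiskerRight f N
  associator := Bimod.associatorBimod
  leftUnitor := Bimod.leftUnitorBimod
  rightUnitor := Bimod.rightUnitorBimod
  whiskerLeft_id _ _ := Bimod.whiskerLeft_id_bimod
  whiskerLeft_comp M _ _ _ f g := Bimod.whiskerLeft_comp_bimod M f g
  id_whiskerLeft := Bimod.id_whiskerLeft_bimod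
  comp_whiskerLeft M N _ _ f := Bimod.comp_whiskerLeft_bimod M N f
  id_whiskerRight _ _ := Bimod.id_whiskerRight_bimod
  comp_whiskerRight f g Q := Bimod.comp_whiskerRight_bimod f g Q
  whiskerRight_id := Bimod.whiskerRight_id_bimod
  whiskerRight_comp := Bimod.whiskerRight_comp_bimod
  whisker_assoc M _ _ f P := Bimod.whisker_assoc_bimod M f P
  whisker_exchange := Bimod.whisker_exchange_bimod
  pentagon := Bimod.pentagon_bimod
  triangle := Bimod.triangle_bimod

variable (V) in
/-- The unit algebra. -/
def unitAlg : Alg V := ⟨Mon.trivial V⟩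

/-- The category `V_A` of right `A`-modules, as bimodules over the unit algebra and `A`: by
`trivial_actLeft` the left action of the unit algebra is no additional data. -/
abbrev RMod (A : Alg V) := unitAlg V ⟶ A

/-- The forgetful functor `V_A ⥤ V`. -/
noncomputable def RMod.forget (A : Alg V) : RMod A ⥤ V where
  obj M := Bimod.X M
  map f := Bimod.Hom.hom f

/-- The functor sending an `A`-`B`-bimodule to its underlying right `B`-module. -/
noncomputable def restrictRight (A B : Alg V) : (A ⟶ B) ⥤ RMod B where
  obj X := restrictRightObj X
  map f := restrictRightMap f

/-- The functor `- ⊗_A X : V_A ⥤ V_B` given by an `A`-`B`-bimodule `X`. -/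
noncomputable def tensorBimodule {A B : Alg V} (X : A ⟶ B) : RMod A ⥤ RMod B :=
  Bicategory.postcomp (unitAlg V) X

/-- An `A`-coring is a comonoid in the monoidal category of `A`-`A`-bimodules. -/
abbrev Coring (A : Alg V) := Comon (A ⟶ A)

/-- The category `V_A^C` of right `(A, C)`-comodules. -/
abbrev Comod {A : Alg V} (C : Coring A) := Comodule (unitAlg V) C

/-- The forgetful functor `V_A^C ⥤ V_A`. -/
noncomputable def Comod.forget {A : Alg V} (C : Coring A) : Comod C ⥤ RMod A :=
  (comoduleComonad (unitAlg V) C).forget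

/-- A left `A`-module `X` (here: the one underlying an `A`-`B`-bimodule) is flat if
`- ⊗_A X : V_A ⥤ V` preserves coreflexive equalizers. -/
def IsFlat {A B : Alg V} (X : A ⟶ B) : Prop :=
  ∀ ⦃M N : RMod A⦄ (f g : M ⟶ N) [IsCoreflexivePair f g],
    PreservesLimit (parallelPair f g) (tensorBimodule X ⋙ RMod.forget B)

end Algebras

/-! ### Model structures -/

section Model

/-- A functor between model categories is left Quillen if it is a left adjoint and preserves
cofibrations and trivial cofibrations. -/
structure IsLeftQuillen {𝒞 : Type*} {𝒟 : Type*} [Category* 𝒞] [Category* 𝒟] [ModelCategory 𝒞]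
    [ModelCategory 𝒟] (F : 𝒞 ⥤ 𝒟) : Prop where
  isLeftAdjoint : F.IsLeftAdjoint
  cofibration {M N : 𝒞} (f : M ⟶ N) (_ : Cofibration f) : Cofibration (F.map f)
  trivialCofibration {M N : 𝒞} (f : M ⟶ N) (_ : Cofibration f) (_ : WeakEquivalence f) :
    Cofibration (F.map f) ∧ WeakEquivalence (F.map f)

/-- An adjunction between model categories is a Quillen equivalence if it is a Quillen adjunction
and, for `M` cofibrant and `N` fibrant, a map `F M ⟶ N` is a weak equivalence if and only if its
adjunct `M ⟶ G N` is. -/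
structure IsQuillenEquivalence {𝒞 : Type*} {𝒟 : Type*} [Category* 𝒞] [Category* 𝒟]
    [ModelCategory 𝒞] [ModelCategory 𝒟] {F : 𝒞 ⥤ 𝒟} {G : 𝒟 ⥤ 𝒞} (adj : F ⊣ G) : Prop where
  isLeftQuillen : IsLeftQuillen F
  weakEquivalence_iff (M : 𝒞) (N : 𝒟) (_ : IsCofibrant M) (_ : IsFibrant N) (f : F.obj M ⟶ N) :
    WeakEquivalence f ↔ WeakEquivalence (adj.homEquiv M N f)

/-- The model structure of `𝒞` is left-induced along `F : 𝒞 ⥤ 𝒟`: a map of `𝒞` is a weak equivalence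
(a cofibration) if and only if its image in `𝒟` is. -/
structure IsLeftInduced {𝒞 : Type*} {𝒟 : Type*} [Category* 𝒞] [Category* 𝒟] [ModelCategory 𝒞]
    [ModelCategory 𝒟] (F : 𝒞 ⥤ 𝒟) : Prop where
  weakEquivalence_iff {M N : 𝒞} (f : M ⟶ N) : WeakEquivalence f ↔ WeakEquivalence (F.map f)
  cofibration_iff {M N : 𝒞} (f : M ⟶ N) : Cofibration f ↔ Cofibration (F.map f)

variable {V : Type u} [Category.{v} V] [MonoidalCategory V]

variable (V) in
/-- The compatibility axiom of a monoidal model category: for cofibrations `i`, `j` and a fibration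
`p`, one of which is a weak equivalence, the pushout-product of `j` and `i` has the left lifting
property with respect to `p`. -/
def PushoutProductAxiom [ModelCategory V] : Prop :=
  ∀ ⦃K L A B X Y : V⦄ (j : K ⟶ L) (i : A ⟶ B) (p : X ⟶ Y),
    Cofibration j → Cofibration i → Fibration p →
    (WeakEquivalence j ∨ WeakEquivalence i ∨ WeakEquivalence p) →
    HasLiftingProperty
      ((MonoidalCategory.Arrow.pushoutProduct.obj (Arrow.mk j)).obj (Arrow.mk i)).hom p

variable [SymmetricCategory V] [MonoidalClosed V] [ModelCategory V]

/-- A left `A`-module `X` (here: the one underlying an `A`-`B`-bimodule) is strongly homotopy flat if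
`- ⊗_A X : V_A ⥤ V` preserves weak equivalences and, up to weak equivalence, finite limits. -/
structure IsStronglyHomotopyFlat {A B : Alg V} [ModelCategory (RMod A)] (X : A ⟶ B) : Prop where
  weakEquivalence ⦃M N : RMod A⦄ (f : M ⟶ N) (_ : WeakEquivalence f) :
    WeakEquivalence ((tensorBimodule X ⋙ RMod.forget B).map f)
  limit_post (J : Type) [SmallCategory J] [FinCategory J] (Φ : J ⥤ RMod A) :
    WeakEquivalence (limit.post Φ (tensorBimodule X ⋙ RMod.forget B))

/-- A bimodule `X` with right dual `Xd` satisfies effective homotopic descent with respect to `C` if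
the canonical adjunction between `C`-comodules and `X_*(C)`-comodules is a Quillen equivalence. -/
def EffectiveHomotopicDescent {A B : Alg V} (C : Coring A) {X : A ⟶ B} {Xd : B ⟶ A}
    (dual : Bicategory.Adjunction X Xd) [ModelCategory (Comod C)]
    [ModelCategory (Comod (canonicalCoring C dual))] : Prop :=
  IsQuillenEquivalence ((universalBraiding C dual).starAdjunction (unitAlg V) dual)

/-- A morphism `f : C ⟶ D` of `A`-corings is a copure weak equivalence if it is a weak equivalence
(of right `A`-modules) and the counit `f_* f^* M ⟶ M` is a weak equivalence for all fibrant right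
`D`-comodules `M`. -/
structure IsCopureWeakEquivalence {A : Alg V} {C D : Coring A} (f : C ⟶ D)
    [ModelCategory (RMod A)] [ModelCategory (Comod C)] [ModelCategory (Comod D)] : Prop where
  weakEquivalence : WeakEquivalence ((restrictRight A A).map f.hom)
  counit (M : Comod D) (_ : IsFibrant M) :
    WeakEquivalence ((changeOfCoringsAdjunction (unitAlg V) f).counit.app M)

end Model

end MoritaTakeuchi

open MoritaTakeuchi

/-! Everything rests on the factorization `lowerStarIso`: up to isomorphism, `T_*` is `Can_X`
followed by the change of corings along `g_T`. A change of corings leaves underlying modules alone,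
so it preserves and reflects weak equivalences of left-induced structures; a copure weak equivalence
then gives a Quillen equivalence, because adjuncts differ from the original maps only by the counit.
Part 1 is the composition of two Quillen equivalences.

For the converse, homotopy flatness makes `T_*` preserve all weak equivalences, and a Quillen
equivalence with this property also reflects them and has weak equivalences as counits at fibrant
objects. Since `Can_X` has the same underlying functor `- ⊗_A X`, it too creates weak equivalences,
so only its counit matters. On a cofree comodule on `Y` the counit of `T_* ⊣ T^*` is `Y ⊗ g_T`
(`exists_iso_counit_cofree`), and for the universal braiding this is an isomorphism. A general
comodule is an equalizer of cofree ones; flatness of `C` and strong homotopy flatness of `X` carry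
this equalizer through `Can_X Prim_X` up to weak equivalence
(`weakEquivalence_counit_universalBraiding`). Taking `Y = B` shows that `g_T` is a weak equivalence,
and two-out-of-three on the counit of the composite adjunction shows that it is copure. -/

namespace MoritaTakeuchi

/-! ### Quillen adjunctions, Quillen equivalences and left-induced model structures. -/

section QuillenAdjunctions

universe v₁ v₂ v₃ u₁ u₂ u₃

variable {𝒞 : Type u₁} [Category.{v₁} 𝒞] [ModelCategory 𝒞]
  {𝒟 : Type u₂} [Category.{v₂} 𝒟] [ModelCategory 𝒟]
  {ℰ : Type u₃} [Category.{v₃} ℰ] [ModelCategory ℰ]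

theorem exists_cofibrant_replacement (X : 𝒞) :
    ∃ (Q : 𝒞) (q : Q ⟶ X), IsCofibrant Q ∧ Fibration q ∧ WeakEquivalence q := by
  let h := MorphismProperty.factorizationData (cofibrations 𝒞) (trivialFibrations 𝒞)
    (initial.to X)
  have hp := (mem_trivialFibrations_iff h.p).1 h.hp
  refine ⟨h.Z, h.p, ?_, hp.1, hp.2⟩
  rw [isCofibrant_iff, Subsingleton.elim (initial.to h.Z) h.i, cofibration_iff]
  exact h.hi

theorem exists_fibrant_replacement (X : 𝒞) :
    ∃ (R : 𝒞) (r : X ⟶ R), IsFibrant R ∧ Cofibration r ∧ WeakEquivalence r := by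
  let h := MorphismProperty.factorizationData (trivialCofibrations 𝒞) (fibrations 𝒞)
    (terminal.from X)
  have hi := (mem_trivialCofibrations_iff h.i).1 h.hi
  refine ⟨h.Z, h.i, ?_, hi.1, hi.2⟩
  rw [isFibrant_iff, Subsingleton.elim (terminal.from h.Z) h.p, fibration_iff]
  exact h.hp

theorem cofibration_map_iff_of_iso {𝒜 : Type*} [Category* 𝒜] {F F' : 𝒜 ⥤ 𝒟} (e : F ≅ F')
    {M N : 𝒜} (f : M ⟶ N) : Cofibration (F.map f) ↔ Cofibration (F'.map f) := by
  rw [cofibration_iff, cofibration_iff]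
  exact (cofibrations 𝒟).arrow_mk_iso_iff
    (((Functor.mapArrowFunctor _ _).mapIso e).app (Arrow.mk f))

theorem weakEquivalence_map_iff_of_iso {𝒜 : Type*} [Category* 𝒜] {F F' : 𝒜 ⥤ 𝒟} (e : F ≅ F')
    {M N : 𝒜} (f : M ⟶ N) : WeakEquivalence (F.map f) ↔ WeakEquivalence (F'.map f) := by
  rw [weakEquivalence_iff, weakEquivalence_iff]
  exact (weakEquivalences 𝒟).arrow_mk_iso_iff
    (((Functor.mapArrowFunctor _ _).mapIso e).app (Arrow.mk f))

namespace IsLeftQuillen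

variable {F : 𝒞 ⥤ 𝒟} {G : 𝒟 ⥤ 𝒞}

theorem fibration_map (hF : IsLeftQuillen F) (adj : F ⊣ G) {X Y : 𝒟} (p : X ⟶ Y)
    (hp : Fibration p) : Fibration (G.map p) := by
  rw [fibration_iff, ← trivialCofibrations_rlp]
  intro A B i hi
  obtain ⟨h₁, h₂⟩ := (mem_trivialCofibrations_iff i).1 hi
  obtain ⟨h₃, h₄⟩ := hF.trivialCofibration i h₁ h₂
  exact (adj.hasLiftingProperty_iff i p).1 inferInstance

theorem isFibrant_obj (hF : IsLeftQuillen F) (adj : F ⊣ G) {X : 𝒟} (hX : IsFibrant X) :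
    IsFibrant (G.obj X) := by
  have : PreservesLimitsOfSize.{0, 0} G := adj.rightAdjoint_preservesLimits
  exact (isFibrant_iff_of_isTerminal (G.map (terminal.from X))
    (IsTerminal.isTerminalObj G _ terminalIsTerminal)).2 (hF.fibration_map adj _ hX)

theorem isCofibrant_obj (hF : IsLeftQuillen F) {X : 𝒞} (hX : IsCofibrant X) :
    IsCofibrant (F.obj X) := by
  have := hF.isLeftAdjoint
  have : PreservesColimitsOfSize.{0, 0} F :=
    (Adjunction.ofIsLeftAdjoint F).leftAdjoint_preservesColimits
  exact (isCofibrant_iff_of_isInitial (F.map (initial.to X))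
    (IsInitial.isInitialObj F _ initialIsInitial)).2 (hF.cofibration _ hX)

theorem comp {F₂ : 𝒟 ⥤ ℰ} (hF : IsLeftQuillen F) (hF₂ : IsLeftQuillen F₂) :
    IsLeftQuillen (F ⋙ F₂) where
  isLeftAdjoint :=
    have := hF.isLeftAdjoint
    have := hF₂.isLeftAdjoint
    inferInstance
  cofibration f hf := hF₂.cofibration _ (hF.cofibration f hf)
  trivialCofibration f hf hf' :=
    have h := hF.trivialCofibration f hf hf'
    hF₂.trivialCofibration _ h.1 h.2

theorem of_iso {F' : 𝒞 ⥤ 𝒟} (e : F ≅ F') (hF : IsLeftQuillen F) : IsLeftQuillen F' := by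
  refine ⟨?_, fun f hf => (cofibration_map_iff_of_iso e f).1 (hF.cofibration f hf),
    fun f hf hf' => ?_⟩
  · have := hF.isLeftAdjoint
    exact Functor.isLeftAdjoint_of_iso e
  · have h := hF.trivialCofibration f hf hf'
    exact ⟨(cofibration_map_iff_of_iso e f).1 h.1, (weakEquivalence_map_iff_of_iso e f).1 h.2⟩

end IsLeftQuillen

namespace IsQuillenEquivalence

variable {F : 𝒞 ⥤ 𝒟} {G : 𝒟 ⥤ 𝒞} {adj : F ⊣ G}

theorem comp {F₂ : 𝒟 ⥤ ℰ} {G₂ : ℰ ⥤ 𝒟} {adj₂ : F₂ ⊣ G₂} (h : IsQuillenEquivalence adj)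
    (h₂ : IsQuillenEquivalence adj₂) : IsQuillenEquivalence (adj.comp adj₂) where
  isLeftQuillen := h.isLeftQuillen.comp h₂.isLeftQuillen
  weakEquivalence_iff M N hM hN f := by
    have e := h₂.weakEquivalence_iff (F.obj M) N (h.isLeftQuillen.isCofibrant_obj hM) hN f
    have e' := h.weakEquivalence_iff M (G₂.obj N) hM (h₂.isLeftQuillen.isFibrant_obj adj₂ hN)
      (adj₂.homEquiv _ _ f)
    rw [Adjunction.comp_homEquiv]
    exact e.trans e'

/-- Comparing the left adjoints is enough: the right adjoints are then isomorphic through mates, and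
corresponding adjuncts differ by these isomorphisms. -/
theorem of_iso {F' : 𝒞 ⥤ 𝒟} {G' : 𝒟 ⥤ 𝒞} {adj' : F' ⊣ G'} (e : F ≅ F')
    (h : IsQuillenEquivalence adj) : IsQuillenEquivalence adj' where
  isLeftQuillen := h.isLeftQuillen.of_iso e
  weakEquivalence_iff M N hM hN f := by
    let i : G ≅ G' := conjugateIsoEquiv adj adj' e.symm
    have h₁ : adj'.homEquiv M N f = adj.homEquiv M N (e.hom.app M ≫ f) ≫ i.hom.app N := by
      have hu : adj.unit.app M ≫ i.hom.app (F.obj M) =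
          adj'.unit.app M ≫ G'.map (e.inv.app M) := unit_conjugateEquiv adj adj' e.inv M
      rw [Adjunction.homEquiv_unit, Adjunction.homEquiv_unit, Category.assoc, i.hom.naturality,
        reassoc_of% hu, ← G'.map_comp, Iso.inv_hom_id_app_assoc]
    rw [h₁, weakEquivalence_postcomp_iff, ← h.weakEquivalence_iff M N hM hN,
      weakEquivalence_precomp_iff]

/-- In general only the derived counit, precomposed with `F` of a cofibrant replacement of `G N`, is
a weak equivalence. As `F` preserves all weak equivalences, the replacement cancels by
two-out-of-three. -/
theorem weakEquivalence_counit (h : IsQuillenEquivalence adj)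
    (hw : ∀ {M N : 𝒞} (f : M ⟶ N), WeakEquivalence f → WeakEquivalence (F.map f))
    (N : 𝒟) (hN : IsFibrant N) : WeakEquivalence (adj.counit.app N) := by
  obtain ⟨Q, q, hQ, -, hq⟩ := exists_cofibrant_replacement (G.obj N)
  have e := (h.weakEquivalence_iff Q N hQ hN (F.map q ≫ adj.counit.app N)).2 (by
    have : adj.homEquiv Q N (F.map q ≫ adj.counit.app N) = q := by
      rw [← Adjunction.homEquiv_counit, Equiv.apply_symm_apply]
    rwa [this])
  have := hw q hq
  exact weakEquivalence_of_precomp (F.map q) _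

/-- Reflection of weak equivalences between cofibrant objects holds for every Quillen equivalence;
it extends to all objects because `F` preserves the cofibrant replacements. -/
theorem weakEquivalence_of_map (h : IsQuillenEquivalence adj)
    (hw : ∀ {M N : 𝒞} (f : M ⟶ N), WeakEquivalence f → WeakEquivalence (F.map f))
    {M N : 𝒞} (f : M ⟶ N) (hf : WeakEquivalence (F.map f)) : WeakEquivalence f := by
  have key {N : 𝒞} (hN : IsCofibrant N) (R : 𝒟) (hR : IsFibrant R) (r : F.obj N ⟶ R)
      (hr : WeakEquivalence r) : WeakEquivalence (adj.homEquiv N R r) :=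
    (h.weakEquivalence_iff N R hN hR r).1 hr
  obtain ⟨QM, p, hM, -, hp⟩ := exists_cofibrant_replacement M
  obtain ⟨QN, q, hN, hq', hq⟩ := exists_cofibrant_replacement N
  have sq : CommSq (initial.to QN) (initial.to QM) q (p ≫ f) := ⟨Subsingleton.elim _ _⟩
  let g : QM ⟶ QN := sq.lift
  have hg : g ≫ q = p ≫ f := sq.fac_right
  have hFp := hw p hp
  have hFq := hw q hq
  have hFg : WeakEquivalence (F.map g) := by
    have : F.map g ≫ F.map q = F.map p ≫ F.map f := by rw [← F.map_comp, hg, F.map_comp]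
    exact weakEquivalence_of_postcomp_of_fac this
  -- One fibrant replacement serves both objects: `r` and `F.map g ≫ r` are weak equivalences into
  -- `R`, and their adjuncts differ by precomposition with `g`.
  obtain ⟨R, r, hR, -, hr⟩ := exists_fibrant_replacement (F.obj QN)
  have h₁ := key hN R hR r hr
  have h₂ := key hM R hR (F.map g ≫ r) inferInstance
  rw [Adjunction.homEquiv_naturality_left] at h₂
  have := weakEquivalence_of_postcomp g (adj.homEquiv QN R r)
  have : WeakEquivalence (p ≫ f) := hg ▸ inferInstance
  exact weakEquivalence_of_precomp p f

theorem of_weakEquivalence_counit (hF : IsLeftQuillen F)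
    (hw : ∀ {M N : 𝒞} (f : M ⟶ N), WeakEquivalence (F.map f) ↔ WeakEquivalence f)
    (hc : ∀ N : 𝒟, IsFibrant N → WeakEquivalence (adj.counit.app N)) :
    IsQuillenEquivalence adj where
  isLeftQuillen := hF
  weakEquivalence_iff M N _ hN f := by
    have := hc N hN
    have h : F.map (adj.homEquiv M N f) ≫ adj.counit.app N = f := by
      exact (adj.homEquiv_counit M N _).symm.trans (Equiv.symm_apply_apply _ _)
    rw [← hw (adj.homEquiv M N f), ← weakEquivalence_postcomp_iff _ (adj.counit.app N), h]

end IsQuillenEquivalence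

namespace IsLeftInduced

variable {U : 𝒞 ⥤ 𝒟}

theorem isLeftQuillen (h : IsLeftInduced U) [U.IsLeftAdjoint] : IsLeftQuillen U where
  isLeftAdjoint := inferInstance
  cofibration f hf := (h.cofibration_iff f).1 hf
  trivialCofibration f hf hf' := ⟨(h.cofibration_iff f).1 hf, (h.weakEquivalence_iff f).1 hf'⟩

/-- A left adjoint lifting a left Quillen functor to left-induced model structures is left
Quillen. -/
theorem isLeftQuillen_of_lift {ℱ : Type*} [Category* ℱ] [ModelCategory ℱ] {U' : ℰ ⥤ ℱ}
    (h : IsLeftInduced U) (h' : IsLeftInduced U') {S : 𝒞 ⥤ ℰ} {L : 𝒟 ⥤ ℱ}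
    (e : U ⋙ L ≅ S ⋙ U') (hL : IsLeftQuillen L) [S.IsLeftAdjoint] : IsLeftQuillen S where
  isLeftAdjoint := inferInstance
  cofibration f hf := (h'.cofibration_iff _).2 <| (cofibration_map_iff_of_iso e f).1 <|
    hL.cofibration _ ((h.cofibration_iff f).1 hf)
  trivialCofibration f hf hf' :=
    have := hL.trivialCofibration _ ((h.cofibration_iff f).1 hf) ((h.weakEquivalence_iff f).1 hf')
    ⟨(h'.cofibration_iff _).2 ((cofibration_map_iff_of_iso e f).1 this.1),
      (h'.weakEquivalence_iff _).2 ((weakEquivalence_map_iff_of_iso e f).1 this.2)⟩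

end IsLeftInduced

end QuillenAdjunctions

/-! ### Factorization of braided bimodules, and counits at cofree comodules. -/

section BraidedBimodules

open Bicategory

universe w v₁ u₁

variable {𝓑 : Type u₁} [Bicategory.{w, v₁} 𝓑] {a b : 𝓑} {C : Comon (a ⟶ a)} {D : Comon (b ⟶ b)}

/-- The coevaluation slides past `T` by the exchange law and then cancels the evaluation by a
triangle identity. This is what makes `lowerStarIso` compatible with coactions. -/
theorem universalBraiding_comp_canonicalMapHom (P : BraidedBimodule C D) {Xd : b ⟶ a}
    (adj : Bicategory.Adjunction P.X Xd) :
    ((λ_ (C.X ≫ P.X)).inv ≫ adj.unit ▷ (C.X ≫ P.X) ≫ (α_ P.X Xd (C.X ≫ P.X)).hom) ≫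
      P.X ◁ canonicalMapHom P adj = P.T := by
  dsimp only [canonicalMapHom]
  calc
    _ = 𝟙 _ ⊗≫ (adj.unit ▷ (C.X ≫ P.X) ≫ (P.X ≫ Xd) ◁ P.T) ⊗≫ P.X ◁ adj.counit ▷ D.X ⊗≫ 𝟙 _ := by
      bicategory
    _ = P.T ⊗≫ leftZigzag adj.unit adj.counit ▷ D.X ⊗≫ 𝟙 _ := by
      rw [← whisker_exchange]; bicategory
    _ = _ := by
      rw [adj.left_triangle]; bicategory

theorem canonicalMapHom_eq (P : BraidedBimodule C D) {Xd : b ⟶ a}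
    (adj : Bicategory.Adjunction P.X Xd) :
    canonicalMapHom P adj =
      Xd ◁ P.T ≫ (α_ Xd P.X D.X).inv ≫ adj.counit ▷ D.X ≫ (λ_ D.X).hom := by
  dsimp only [canonicalMapHom]
  bicategory

theorem canonicalMapHom_universalBraiding (C : Comon (a ⟶ a)) {X : a ⟶ b} {Xd : b ⟶ a}
    (adj : Bicategory.Adjunction X Xd) :
    canonicalMapHom (universalBraiding C adj) adj = 𝟙 (Xd ≫ C.X ≫ X) := by
  refine (canonicalMapHom_eq (universalBraiding C adj) adj).trans ?_
  change Xd ◁ ((λ_ (C.X ≫ X)).inv ≫ adj.unit ▷ (C.X ≫ X) ≫ (α_ X Xd (C.X ≫ X)).hom) ≫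
    (α_ Xd X (Xd ≫ C.X ≫ X)).inv ≫ adj.counit ▷ (Xd ≫ C.X ≫ X) ≫ (λ_ (Xd ≫ C.X ≫ X)).hom = _
  calc
    _ = 𝟙 _ ⊗≫ rightZigzag adj.unit adj.counit ▷ (C.X ≫ X) ⊗≫ 𝟙 _ := by bicategory
    _ = _ := by
      rw [adj.right_triangle]; bicategory

/-- A braided bimodule factors as the universal braided bimodule followed by the change of corings
along its canonical map. -/
def lowerStarIso (k : 𝓑) (P : BraidedBimodule C D) {Xd : b ⟶ a}
    (adj : Bicategory.Adjunction P.X Xd) :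
    (universalBraiding C adj).lowerStar k ⋙ changeOfCorings k (canonicalMap P adj) ≅
      P.lowerStar k :=
  NatIso.ofComponents (fun M => CategoryTheory.Comonad.Coalgebra.isoMk (Iso.refl (M.A ≫ P.X)) (by
      have h := congrArg (fun t => M.A ◁ t) (universalBraiding_comp_canonicalMapHom P adj)
      change ((M.coact ▷ P.X ≫ (α_ M.A C.X P.X).hom ≫
        M.A ◁ ((λ_ (C.X ≫ P.X)).inv ≫ adj.unit ▷ (C.X ≫ P.X) ≫ (α_ P.X Xd (C.X ≫ P.X)).hom) ≫
        (α_ M.A P.X (Xd ≫ C.X ≫ P.X)).inv) ≫ (M.A ≫ P.X) ◁ canonicalMapHom P adj) ≫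
        𝟙 (M.A ≫ P.X) ▷ D.X = 𝟙 (M.A ≫ P.X) ≫ M.coact ▷ P.X ≫ (α_ M.A C.X P.X).hom ≫ M.A ◁ P.T ≫
          (α_ M.A P.X D.X).inv
      rw [← h]
      bicategory))
    (by
      intro M N f
      ext
      exact (Category.comp_id _).trans (Category.id_comp _).symm)

/-- After comultiplication `T` acts on the right-hand copy of `C` and the counit on the left-hand
one. They exchange, the counit cancels `Δ`, and `T` followed by evaluation remains. -/
theorem lowerStar_cofree_coact (k : 𝓑) (P : BraidedBimodule C D) {Xd : b ⟶ a}
    (adj : Bicategory.Adjunction P.X Xd) (Y : k ⟶ b) :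
    (((Y ≫ Xd) ◁ Δ[C.X] ≫ (α_ (Y ≫ Xd) C.X C.X).inv) ▷ P.X ≫
      (α_ ((Y ≫ Xd) ≫ C.X) C.X P.X).hom ≫ ((Y ≫ Xd) ≫ C.X) ◁ P.T ≫
      (α_ ((Y ≫ Xd) ≫ C.X) P.X D.X).inv) ≫
      (((Y ≫ Xd) ◁ ε[C.X] ≫ (ρ_ (Y ≫ Xd)).hom) ▷ P.X ≫ (α_ Y Xd P.X).hom ≫ Y ◁ adj.counit ≫
        (ρ_ Y).hom) ▷ D.X =
      (α_ (Y ≫ Xd) C.X P.X).hom ≫ (α_ Y Xd (C.X ≫ P.X)).hom ≫ Y ◁ canonicalMapHom P adj := by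
  dsimp only [canonicalMapHom]
  calc
    _ = 𝟙 _ ⊗≫ (Y ≫ Xd) ◁ Δ[C.X] ▷ P.X ⊗≫ (Y ≫ Xd) ◁ (C.X ◁ P.T ≫ ε[C.X] ▷ (P.X ≫ D.X)) ⊗≫
        Y ◁ adj.counit ▷ D.X ⊗≫ 𝟙 (Y ≫ D.X) := by bicategory
    _ = 𝟙 _ ⊗≫ (Y ≫ Xd) ◁ (Δ[C.X] ≫ ε[C.X] ▷ C.X) ▷ P.X ⊗≫ (Y ≫ Xd) ◁ P.T ⊗≫
        Y ◁ adj.counit ▷ D.X ⊗≫ 𝟙 (Y ≫ D.X) := by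
      rw [whisker_exchange]; bicategory
    _ = _ := by
      rw [Comonad.counit_comul]; bicategory

/-- The universal property of cofree comodules: a colinear map `f` is recovered from its composite
with the counit. Only colinearity of `f` and one counit law of `D` enter. -/
theorem eq_coact_comp_of_comul {k : 𝓑} {N Y : k ⟶ b} (c : N ⟶ N ≫ D.X) (f : N ⟶ Y ≫ D.X)
    (h : c ≫ f ▷ D.X = f ≫ Y ◁ Δ[D.X] ≫ (α_ Y D.X D.X).inv) :
    f = c ≫ (f ≫ Y ◁ ε[D.X] ≫ (ρ_ Y).hom) ▷ D.X := by
  have e : Y ◁ (Δ[D.X] ≫ ε[D.X] ▷ D.X) = Y ◁ (λ_ D.X).inv := by rw [Comonad.counit_comul]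
  rw [comp_whiskerRight, reassoc_of% h]
  calc
    f = f ≫ Y ◁ (λ_ D.X).inv ⊗≫ 𝟙 _ := by bicategory
    _ = _ := by
      rw [← e]; bicategory

theorem comodule_hom_cofree (k : 𝓑) {N : Comodule k D} {Y : k ⟶ b}
    (φ : N ⟶ (comoduleComonad k D).cofree.obj Y) :
    φ.f = N.a ≫ (comoduleComonad k D).toFunctor.map (φ.f ≫ (comoduleComonad k D).ε.app Y) :=
  eq_coact_comp_of_comul N.a φ.f φ.h

/-- The counit of `T_* ⊣ T^*` at a cofree comodule is given by the canonical map. -/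
theorem exists_iso_counit_cofree (k : 𝓑) (P : BraidedBimodule C D) {Xd : b ⟶ a}
    (adj : Bicategory.Adjunction P.X Xd) {Q : Comodule k D ⥤ Comodule k C}
    (adj' : CategoryTheory.Adjunction (P.lowerStar k) Q) (Y : k ⟶ b) :
    ∃ e : Y ≫ Xd ≫ C.X ≫ P.X ≅
        ((P.lowerStar k).obj (Q.obj ((comoduleComonad k D).cofree.obj Y))).A,
      e.hom ≫ (adj'.counit.app ((comoduleComonad k D).cofree.obj Y)).f =
        Y ◁ canonicalMapHom P adj := by
  let adj₁ := adj'.comp (comoduleComonad k D).adj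
  let adj₂ := (comoduleComonad k C).adj.comp (postcompAdjunction k adj)
  -- Both composite adjunctions have the left adjoint `M ↦ M ⊗ X`, so their right adjoints agree:
  -- `T^*` of the cofree comodule on `Y` is cofree on `Y ⊗ Xd`.
  let i : (comoduleComonad k D).cofree ⋙ Q ≅ postcomp k Xd ⋙ (comoduleComonad k C).cofree :=
    conjugateIsoEquiv adj₁ adj₂ (Iso.refl ((comoduleComonad k C).forget ⋙ postcomp k P.X))
  let Z := (comoduleComonad k D).cofree.obj Y
  let M := (comoduleComonad k C).cofree.obj (Y ≫ Xd)
  let c : ((P.lowerStar k).obj (Q.obj Z)).A ⟶ Y := adj₁.counit.app Y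
  let d : ((P.lowerStar k).obj M).A ⟶ Y := adj₂.counit.app Y
  let j : (P.lowerStar k).obj (Q.obj Z) ≅ (P.lowerStar k).obj M := (P.lowerStar k).mapIso (i.app Y)
  have hj : j.hom.f ≫ d = c :=
    (conjugateEquiv_counit adj₁ adj₂ (𝟙 _) Y).trans (Category.id_comp _)
  have hj' : d = j.inv.f ≫ c := by
    rw [← hj, ← Category.assoc, ← Comonad.Coalgebra.comp_f, j.inv_hom_id]
    exact (Category.id_comp _).symm
  have h₁ : c = (adj'.counit.app Z).f ≫ (comoduleComonad k D).ε.app Y := by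
    dsimp only [c, adj₁]
    rw [Adjunction.comp_counit_app]
    simp only [Comonad.adj_counit]
    rfl
  have h₂ : d = ((Y ≫ Xd) ◁ ε[C.X] ≫ (ρ_ (Y ≫ Xd)).hom) ▷ P.X ≫
      (α_ Y Xd P.X).hom ≫ Y ◁ adj.counit ≫ (ρ_ Y).hom := by
    dsimp only [d, adj₂]
    rw [Adjunction.comp_counit_app]
    simp only [Comonad.adj_counit]
    rfl
  -- A map into the cofree comodule on `Y` is determined by its adjunct into `Y`, which here is `d`.
  have hφ : (j.inv ≫ adj'.counit.app Z).f = ((P.lowerStar k).obj M).a ≫ d ▷ D.X :=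
    (comodule_hom_cofree k (j.inv ≫ adj'.counit.app Z)).trans
      (congrArg (fun t => ((P.lowerStar k).obj M).a ≫ t ▷ D.X)
        ((Category.assoc _ _ _).trans ((congrArg (j.inv.f ≫ ·) h₁.symm).trans hj'.symm)))
  have hφ' : (j.inv ≫ adj'.counit.app Z).f =
      (α_ (Y ≫ Xd) C.X P.X).hom ≫ (α_ Y Xd (C.X ≫ P.X)).hom ≫ Y ◁ canonicalMapHom P adj := by
    rw [← lowerStar_cofree_coact k P adj Y, hφ, h₂]
    rfl
  let j' : ((Y ≫ Xd) ≫ C.X) ≫ P.X ≅ ((P.lowerStar k).obj (Q.obj Z)).A :=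
    ((comoduleComonad k D).forget.mapIso j).symm
  refine ⟨(α_ Y Xd (C.X ≫ P.X)).symm ≪≫ (α_ (Y ≫ Xd) C.X P.X).symm ≪≫ j', ?_⟩
  let q : ((P.lowerStar k).obj (Q.obj Z)).A ⟶ Y ≫ D.X := (adj'.counit.app Z).f
  have hq : j'.hom ≫ q =
    (α_ (Y ≫ Xd) C.X P.X).hom ≫ (α_ Y Xd (C.X ≫ P.X)).hom ≫ Y ◁ canonicalMapHom P adj := hφ'
  change ((α_ Y Xd (C.X ≫ P.X)).inv ≫ (α_ (Y ≫ Xd) C.X P.X).inv ≫ j'.hom) ≫ q = _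
  rw [Category.assoc, Category.assoc, hq, Iso.inv_hom_id_assoc, Iso.inv_hom_id_assoc]

/-- The canonical map of the universal braiding is the identity, so the counit is invertible on
underlying 1-morphisms, hence on comodules. -/
theorem isIso_counit_cofree_universalBraiding (k : 𝓑) (C : Comon (a ⟶ a)) {X : a ⟶ b}
    {Xd : b ⟶ a} (adj : Bicategory.Adjunction X Xd)
    {Q : Comodule k (canonicalCoring C adj) ⥤ Comodule k C}
    (adj' : CategoryTheory.Adjunction ((universalBraiding C adj).lowerStar k) Q) (Y : k ⟶ b) :
    IsIso (adj'.counit.app ((comoduleComonad k (canonicalCoring C adj)).cofree.obj Y)) := by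
  obtain ⟨e, he⟩ := exists_iso_counit_cofree k (universalBraiding C adj) adj adj' Y
  let q : _ ⟶ Y ≫ Xd ≫ C.X ≫ X :=
    (adj'.counit.app ((comoduleComonad k (canonicalCoring C adj)).cofree.obj Y)).f
  have hq : q = e.inv := by
    refine (cancel_epi e.hom).1 (Eq.trans ?_ e.hom_inv_id.symm)
    refine he.trans ((congrArg (Y ◁ ·) (canonicalMapHom_universalBraiding C adj)).trans ?_)
    exact Bicategory.whiskerLeft_id Y _
  have : IsIso (adj'.counit.app
      ((comoduleComonad k (canonicalCoring C adj)).cofree.obj Y)).f := by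
    change IsIso q
    rw [hq]
    exact e.symm.isIso_hom
  exact Comonad.coalgebra_iso_of_iso _ _

end BraidedBimodules

theorem isCoreflexivePair_functor_map {𝒜 𝒟 : Type*} [Category* 𝒜] [Category* 𝒟] (F : 𝒜 ⥤ 𝒟)
    {M N : 𝒜} (f g : M ⟶ N) [IsCoreflexivePair f g] : IsCoreflexivePair (F.map f) (F.map g) :=
  IsCoreflexivePair.mk' (F.map (commonRetraction f g))
    (by rw [← F.map_comp, left_comp_retraction, F.map_id])
    (by rw [← F.map_comp, right_comp_retraction, F.map_id])

/-! ### Equalizers of modules and comodules; restriction of bimodules to right modules. -/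

section Modules

variable {V : Type u} [Category.{v} V] [MonoidalCategory V] [SymmetricCategory V]
  [MonoidalClosed V] [HasCoequalizers V]

theorem RMod.actLeft_comp {A : Alg V} (M N : RMod A) (f : Bimod.X M ⟶ Bimod.X N) :
    Bimod.actLeft M ≫ f =
      MonoidalCategory.whiskerLeft (MonoidalCategory.tensorUnit V) f ≫ Bimod.actLeft N := by
  have hM : Bimod.actLeft M = _ := trivial_actLeft (A := A.toMon) M
  have hN : Bimod.actLeft N = _ := trivial_actLeft (A := A.toMon) N
  rw [hM, hN]
  exact (MonoidalCategory.leftUnitor_naturality f).symm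

/-- A cone of right modules whose image in `V` is a limit cone is a limit cone. -/
noncomputable def RMod.isLimitOfForget {J : Type*} [Category* J] {A : Alg V} {F : J ⥤ RMod A}
    (c : Cone F) (h : IsLimit ((RMod.forget A).mapCone c)) : IsLimit c where
  lift s :=
    { hom := h.lift ((RMod.forget A).mapCone s)
      left_act_hom := RMod.actLeft_comp s.pt c.pt (h.lift ((RMod.forget A).mapCone s))
      right_act_hom := by
        -- The action occurs on the source side, so joint monicity of the projections suffices; `- ⊗
        -- A` need not preserve the limit.
        refine h.hom_ext fun j => ?_
        let l : Bimod.X s.pt ⟶ Bimod.X c.pt := h.lift ((RMod.forget A).mapCone s)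
        let p : Bimod.X c.pt ⟶ Bimod.X (F.obj j) := Bimod.Hom.hom (c.π.app j)
        let q : Bimod.X s.pt ⟶ Bimod.X (F.obj j) := Bimod.Hom.hom (s.π.app j)
        have hl : l ≫ p = q := h.fac ((RMod.forget A).mapCone s) j
        have hp : Bimod.actRight c.pt ≫ p = _ ≫ _ := Bimod.Hom.right_act_hom (c.π.app j)
        have hq : Bimod.actRight s.pt ≫ q = _ ≫ _ := Bimod.Hom.right_act_hom (s.π.app j)
        change (Bimod.actRight s.pt ≫ l) ≫ p =
          (MonoidalCategory.whiskerRight l A.toMon.X ≫ Bimod.actRight c.pt) ≫ p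
        rw [Category.assoc, Category.assoc, hl, hp, hq, ← MonoidalCategory.comp_whiskerRight_assoc]
        exact congrArg (fun t => MonoidalCategory.whiskerRight t A.toMon.X ≫
          Bimod.actRight (F.obj j)) hl.symm }
  fac s j := Bimod.hom_ext _ _ (h.fac ((RMod.forget A).mapCone s) j)
  uniq s m hm := Bimod.hom_ext _ _ (h.uniq ((RMod.forget A).mapCone s) m.hom
    fun j => congrArg Bimod.Hom.hom (hm j))

instance (A : Alg V) : ReflectsLimitsOfShape WalkingParallelPair (RMod.forget A) where
  reflectsLimit := ⟨fun h => ⟨RMod.isLimitOfForget _ h⟩⟩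

/-- Restriction along the unit commutes with tensoring on the right. -/
noncomputable def restrictRightTensorIso {A B E : Alg V} (X : A ⟶ B) (Y : B ⟶ E) :
    (restrictRight A E).obj (X ≫ Y) ≅ (restrictRight A B).obj X ≫ Y :=
  -- The coequalizer defining `X ⊗_B Y` involves only the right action on `X` and the left action on
  -- `Y`, which restriction keeps; hence the identity underlies the isomorphism.
  Bimod.isoOfIso (P := restrictRightObj (Bimod.tensorBimod X Y))
    (Q := Bimod.tensorBimod (restrictRightObj X) Y) (Iso.refl (Bimod.TensorBimod.X X Y))
    (RMod.actLeft_comp ((restrictRight A E).obj (X ≫ Y)) ((restrictRight A B).obj X ≫ Y) (𝟙 _))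
    (by
      change Bimod.TensorBimod.actRight X Y ≫ 𝟙 (Bimod.TensorBimod.X X Y) =
        MonoidalCategory.whiskerRight (𝟙 (Bimod.TensorBimod.X X Y)) E.toMon.X ≫
          Bimod.TensorBimod.actRight X Y
      rw [MonoidalCategory.id_whiskerRight, Category.comp_id, Category.id_comp])

open Bicategory in
theorem restrictRightTensorIso_naturality {A B E : Alg V} (X : A ⟶ B) {Y Z : B ⟶ E} (f : Y ⟶ Z) :
    (restrictRight A E).map (X ◁ f) ≫ (restrictRightTensorIso X Z).hom =
      (restrictRightTensorIso X Y).hom ≫ (restrictRight A B).obj X ◁ f := by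
  apply Bimod.hom_ext
  exact (Category.comp_id _).trans (Category.id_comp _).symm

open Bicategory in
/-- The right module underlying a bimodule `Y` is the regular right module tensored with `Y`. -/
noncomputable def restrictRightIso (A B : Alg V) :
    restrictRight A B ≅ precomp B ((restrictRight A A).obj (𝟙 A)) :=
  NatIso.ofComponents
    (fun Y => (restrictRight A B).mapIso (λ_ Y).symm ≪≫ restrictRightTensorIso (𝟙 A) Y) (by
      intro Y Z f
      have h : f ≫ (λ_ Z).inv = (λ_ Y).inv ≫ 𝟙 A ◁ f := by simp
      have h' := restrictRightTensorIso_naturality (𝟙 A) f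
      change (restrictRight A B).map f ≫ (restrictRight A B).map (λ_ Z).inv ≫
        (restrictRightTensorIso (𝟙 A) Z).hom = ((restrictRight A B).map (λ_ Y).inv ≫
        (restrictRightTensorIso (𝟙 A) Y).hom) ≫ (restrictRight A A).obj (𝟙 A) ◁ f
      rw [Category.assoc, ← h', ← Functor.map_comp_assoc, ← Functor.map_comp_assoc, h])

theorem IsFlat.preservesLimit {A B : Alg V} {X : A ⟶ B} (hX : IsFlat X)
    (F : WalkingParallelPair ⥤ RMod A)
    [IsCoreflexivePair (F.map WalkingParallelPairHom.left) (F.map WalkingParallelPairHom.right)] :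
    PreservesLimit F (Bicategory.postcomp (unitAlg V) X) := by
  have : PreservesLimit _ (Bicategory.postcomp (unitAlg V) X ⋙ RMod.forget B) :=
    hX (F.map WalkingParallelPairHom.left) (F.map WalkingParallelPairHom.right)
  have : PreservesLimit F (Bicategory.postcomp (unitAlg V) X ⋙ RMod.forget B) :=
    preservesLimit_of_iso_diagram _ (diagramIsoParallelPair F).symm
  exact preservesLimit_of_reflects_of_preserves (Bicategory.postcomp (unitAlg V) X) (RMod.forget B)

/-- A comonadic forgetful functor creates the limits that the comonad and its square preserve, and
flatness provides both for coreflexive pairs. -/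
theorem Comod.forget_preservesLimit {A : Alg V} {C : Coring A} (hC : IsFlat C.X)
    [HasEqualizers (RMod A)] (F : WalkingParallelPair ⥤ Comod C)
    [IsCoreflexivePair (F.map WalkingParallelPairHom.left) (F.map WalkingParallelPairHom.right)] :
    PreservesLimit F (Comod.forget C) := by
  let G := comoduleComonad (unitAlg V) C
  have h₁ : IsCoreflexivePair ((F ⋙ G.forget).map WalkingParallelPairHom.left)
      ((F ⋙ G.forget).map WalkingParallelPairHom.right) := isCoreflexivePair_functor_map G.forget _ _
  have h₂ : IsCoreflexivePair (((F ⋙ G.forget) ⋙ G.toFunctor).map WalkingParallelPairHom.left)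
      (((F ⋙ G.forget) ⋙ G.toFunctor).map WalkingParallelPairHom.right) :=
    isCoreflexivePair_functor_map G.toFunctor _ _
  have h₃ : PreservesLimit (F ⋙ G.forget) G.toFunctor := hC.preservesLimit (F ⋙ G.forget)
  have h₄ : PreservesLimit ((F ⋙ G.forget) ⋙ G.toFunctor) G.toFunctor :=
    hC.preservesLimit ((F ⋙ G.forget) ⋙ G.toFunctor)
  exact preservesLimit_of_createsLimit_and_hasLimit F G.forget

end Modules

/-- Frees the comparison map from the chosen limits: `g` is `limit.post` up to isomorphisms on both
sides. -/
theorem weakEquivalence_of_limit_post {J : Type*} [Category* J] {𝒜 𝒟 : Type*} [Category* 𝒜]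
    [Category* 𝒟] [ModelCategory 𝒟] {F : J ⥤ 𝒜} (H : 𝒜 ⥤ 𝒟) [HasLimit F] [HasLimit (F ⋙ H)]
    (hH : WeakEquivalence (limit.post F H)) {c : Cone F} (hc : IsLimit c) {G : J ⥤ 𝒟}
    (e : F ⋙ H ≅ G) {d : Cone G} (hd : IsLimit d) (g : H.obj c.pt ⟶ d.pt)
    (hg : ∀ j, g ≫ d.π.app j = H.map (c.π.app j) ≫ e.hom.app j) : WeakEquivalence g := by
  let i : H.obj c.pt ≅ H.obj (limit F) := H.mapIso (hc.conePointUniqueUpToIso (limit.isLimit F))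
  let j : limit (F ⋙ H) ≅ d.pt := (limit.isLimit (F ⋙ H)).conePointsIsoOfNatIso hd e
  have : g = i.hom ≫ limit.post F H ≫ j.hom := by
    refine hd.hom_ext fun k => ?_
    rw [hg]
    simp [i, j, ← H.map_comp_assoc]
  rw [this]
  infer_instance

/-! ### The counit of the canonical adjunction at an arbitrary comodule. -/

section Descent

variable {V : Type u} [Category.{v} V] [MonoidalCategory V] [SymmetricCategory V]
  [MonoidalClosed V] [ModelCategory V]

/-- The image in `V` of the canonical resolution of a comodule by cofree comodules is a limit. -/
noncomputable def beckForkIsLimit {B : Alg V} {K : Coring B} (N : Comod K) :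
    IsLimit ((Comod.forget K ⋙ RMod.forget B).mapCone (Comonad.beckCoalgebraFork N)) := by
  -- The fork splits once the coaction is forgotten, and split equalizers survive every functor; no
  -- flatness of `K` is needed.
  let h : IsSplitEqualizer _ _ _ := (Comonad.beckSplitEqualizer N).map (RMod.forget B)
  exact (isLimitMapConeForkEquiv (Comod.forget K ⋙ RMod.forget B)
    (Comonad.CofreeEqualizer.condition N)).symm h.isEqualizer

/-- The counit at `N` is, up to isomorphism, the comparison between `- ⊗_A X` of the equalizer
computing `Prim_X N` and the equalizer of the tensored diagram. Strong homotopy flatness is applied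
to this finite limit, and `N` need not be fibrant. -/
theorem weakEquivalence_counit_universalBraiding
    {A B : Alg V} [ModelCategory (RMod A)] {C : Coring A} {X : A ⟶ B} {Xd : B ⟶ A} (dual : Bicategory.Adjunction X Xd)
    (hC : IsFlat C.X) (hX : IsStronglyHomotopyFlat X)
    {Q : Comod (canonicalCoring C dual) ⥤ Comod C}
    (adj : CategoryTheory.Adjunction ((universalBraiding C dual).lowerStar (unitAlg V)) Q)
    (N : Comod (canonicalCoring C dual)) :
    WeakEquivalence ((RMod.forget B).map ((Comod.forget _).map (adj.counit.app N))) := by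
  let S := (universalBraiding C dual).lowerStar (unitAlg V)
  let U := Comod.forget (canonicalCoring C dual) ⋙ RMod.forget B
  let Ψ := parallelPair (Comonad.CofreeEqualizer.topMap N) (Comonad.CofreeEqualizer.bottomMap N)
  have := adj.rightAdjoint_preservesLimits
  let c := (Comod.forget C).mapCone (Q.mapCone (Comonad.beckCoalgebraFork N))
  have : IsCoreflexivePair ((Ψ ⋙ Q).map WalkingParallelPairHom.left)
      ((Ψ ⋙ Q).map WalkingParallelPairHom.right) :=
    isCoreflexivePair_functor_map Q (Comonad.CofreeEqualizer.topMap N)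
      (Comonad.CofreeEqualizer.bottomMap N)
  have := Comod.forget_preservesLimit hC (Ψ ⋙ Q)
  have hc : IsLimit c := isLimitOfPreserves (Comod.forget C)
    (isLimitOfPreserves Q (Comonad.beckCoalgebraEqualizer N))
  -- Both objects of the Beck pair are cofree.
  have hε (j : WalkingParallelPair) : IsIso (adj.counit.app (Ψ.obj j)) := by
    cases j <;> exact isIso_counit_cofree_universalBraiding _ C dual adj _
  let e : ((Ψ ⋙ Q) ⋙ Comod.forget C) ⋙ (tensorBimodule X ⋙ RMod.forget B) ≅ Ψ ⋙ U :=
    NatIso.ofComponents (fun j => U.mapIso (asIso (adj.counit.app (Ψ.obj j)))) (by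
      intro j j' f
      exact (U.map_comp _ _).symm.trans ((congrArg U.map (adj.counit.naturality (Ψ.map f))).trans
        (U.map_comp _ _)))
  refine weakEquivalence_of_limit_post (tensorBimodule X ⋙ RMod.forget B)
    (hX.limit_post WalkingParallelPair ((Ψ ⋙ Q) ⋙ Comod.forget C)) hc e (beckForkIsLimit N)
    (U.map (adj.counit.app N)) fun j => ?_
  exact (U.map_comp _ _).symm.trans ((congrArg U.map (adj.counit.naturality
    ((Comonad.beckCoalgebraFork N).π.app j)).symm).trans (U.map_comp _ _))

end Descent

/-! ### Weak equivalences and Quillen functors between comodule categories. -/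

section Comodules

variable {V : Type u} [Category.{v} V] [MonoidalCategory V] [SymmetricCategory V]
  [MonoidalClosed V] [ModelCategory V] [∀ A : Alg V, ModelCategory (RMod A)]
  [∀ (A : Alg V) (C : Coring A), ModelCategory (Comod C)]

/-- The right-hand side does not involve `T`, so `T_*` and `Can_X` send the same maps to weak
equivalences. -/
theorem weakEquivalence_lowerStar_map_iff
    (hind : ∀ (A : Alg V) (C : Coring A), IsLeftInduced (Comod.forget C))
    {A B : Alg V} {C : Coring A} {D : Coring B} (P : BraidedBimodule C D) {M N : Comod C}
    (f : M ⟶ N) : WeakEquivalence ((P.lowerStar (unitAlg V)).map f) ↔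
      WeakEquivalence ((tensorBimodule P.X).map ((Comod.forget C).map f)) :=
  (hind B D).weakEquivalence_iff _

theorem isLeftQuillen_lowerStar
    (hind : ∀ (A : Alg V) (C : Coring A), IsLeftInduced (Comod.forget C))
    {A B : Alg V} {C : Coring A} {D : Coring B} (P : BraidedBimodule C D)
    {Xd : B ⟶ A} (dual : Bicategory.Adjunction P.X Xd)
    (hX : IsLeftQuillen (tensorBimodule P.X)) : IsLeftQuillen (P.lowerStar (unitAlg V)) :=
  have := isLeftAdjoint_lowerStar (unitAlg V) P dual
  (hind A C).isLeftQuillen_of_lift (hind B D)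
    (Iso.refl (Comod.forget C ⋙ tensorBimodule P.X)) hX

theorem weakEquivalence_changeOfCorings_map_iff
    (hind : ∀ (A : Alg V) (C : Coring A), IsLeftInduced (Comod.forget C))
    {A : Alg V} {C D : Coring A} (g : C ⟶ D) {M N : Comod C} (f : M ⟶ N) :
    WeakEquivalence ((changeOfCorings (unitAlg V) g).map f) ↔ WeakEquivalence f :=
  ((hind A D).weakEquivalence_iff _).trans ((hind A C).weakEquivalence_iff f).symm

theorem isLeftQuillen_changeOfCorings
    (hind : ∀ (A : Alg V) (C : Coring A), IsLeftInduced (Comod.forget C))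
    {A : Alg V} {C D : Coring A} (g : C ⟶ D) :
    IsLeftQuillen (changeOfCorings (unitAlg V) g) where
  isLeftAdjoint := isLeftAdjoint_changeOfCorings (unitAlg V) g
  cofibration f hf := ((hind A D).cofibration_iff _).2 (((hind A C).cofibration_iff f).1 hf)
  trivialCofibration f hf hf' :=
    ⟨((hind A D).cofibration_iff _).2 (((hind A C).cofibration_iff f).1 hf),
      (weakEquivalence_changeOfCorings_map_iff hind g f).2 hf'⟩

theorem isQuillenEquivalence_changeOfCorings
    (hind : ∀ (A : Alg V) (C : Coring A), IsLeftInduced (Comod.forget C))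
    {A : Alg V} {C D : Coring A} {g : C ⟶ D} (hg : IsCopureWeakEquivalence g) :
    IsQuillenEquivalence (changeOfCoringsAdjunction (unitAlg V) g) :=
  .of_weakEquivalence_counit (isLeftQuillen_changeOfCorings hind g)
    (weakEquivalence_changeOfCorings_map_iff hind g) hg.counit

open Bicategory in
theorem weakEquivalence_restrictRight_canonicalMap
    (hind : ∀ (A : Alg V) (C : Coring A), IsLeftInduced (Comod.forget C))
    {A B : Alg V} {C : Coring A} {D : Coring B} (P : BraidedBimodule C D)
    {Xd : B ⟶ A} (dual : Bicategory.Adjunction P.X Xd)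
    (hB : IsFibrant ((restrictRight B B).obj (𝟙 B)))
    (hc : ∀ N : Comod D, IsFibrant N →
      WeakEquivalence ((P.starAdjunction (unitAlg V) dual).counit.app N)) :
    WeakEquivalence ((restrictRight B B).map (canonicalMap P dual).hom) := by
  -- This replaces `g_T` by `B ⊗_B g_T`, the shape in which the counit at the cofree comodule on `B`
  -- presents it.
  rw [weakEquivalence_map_iff_of_iso (restrictRightIso B B)]
  let G := comoduleComonad (unitAlg V) D
  let Y : RMod B := (restrictRight B B).obj (𝟙 B)
  have : (Comod.forget D).IsLeftAdjoint := inferInstanceAs G.forget.IsLeftAdjoint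
  -- The forgetful functor is left Quillen by left induction, so its right adjoint, the cofree
  -- functor, preserves fibrant objects.
  have hY : IsFibrant (G.cofree.obj Y) := (hind B D).isLeftQuillen.isFibrant_obj G.adj hB
  have hw := ((hind B D).weakEquivalence_iff _).1 (hc _ hY)
  obtain ⟨e, he⟩ := exists_iso_counit_cofree (unitAlg V) P dual
    (P.starAdjunction (unitAlg V) dual) Y
  change WeakEquivalence (Y ◁ canonicalMapHom P dual)
  rw [← he]
  exact (weakEquivalence_precomp_iff e.hom _).2 hw

end Comodules

end MoritaTakeuchi

/-! ### The homotopical Morita–Takeuchi theorem. -/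

theorem mainTheorem1 {V : Type u} [Category.{v} V] [MonoidalCategory V] [SymmetricCategory V]
    [MonoidalClosed V] [ModelCategory V] (hV : PushoutProductAxiom V)
    [∀ A : Alg V, ModelCategory (RMod A)]
    [∀ (A : Alg V) (C : Coring A), ModelCategory (Comod C)]
    (hind : ∀ (A : Alg V) (C : Coring A), IsLeftInduced (Comod.forget C))
    {A B : Alg V} {C : Coring A} {D : Coring B} (P : BraidedBimodule C D)
    {Xd : B ⟶ A} (dual : Bicategory.Adjunction P.X Xd)
    (hX : IsLeftQuillen (tensorBimodule P.X)) :
    (EffectiveHomotopicDescent C dual ∧ IsCopureWeakEquivalence (canonicalMap P dual) →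
      IsQuillenEquivalence (P.starAdjunction (unitAlg V) dual)) ∧
    ((∀ {M N : RMod B} (f : M ⟶ N), WeakEquivalence ((RMod.forget B).map f) → WeakEquivalence f) →
      IsFibrant ((restrictRight B B).obj (𝟙 B)) →
      IsFlat C.X →
      IsStronglyHomotopyFlat P.X →
      IsQuillenEquivalence (P.starAdjunction (unitAlg V) dual) →
      EffectiveHomotopicDescent C dual ∧ IsCopureWeakEquivalence (canonicalMap P dual)) := by
  refine ⟨fun ⟨hd, hg⟩ => ?_, fun hw hB hC hP hT => ?_⟩
  · exact (hd.comp (isQuillenEquivalence_changeOfCorings hind hg)).of_iso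
      (lowerStarIso (unitAlg V) P dual)
  · let k := unitAlg V
    let K := canonicalCoring C dual
    let S := (universalBraiding C dual).lowerStar k
    have hpres {M N : Comod C} (f : M ⟶ N) (hf : WeakEquivalence f) :
        WeakEquivalence ((P.lowerStar k).map f) :=
      (weakEquivalence_lowerStar_map_iff hind P f).2
        (hw _ (hP.weakEquivalence _ (((hind A C).weakEquivalence_iff f).1 hf)))
    -- Reflection is known for `T_*` from the Quillen equivalence and passes to `Can_X` through the
    -- common underlying functor `- ⊗_A X`.
    have hS {M N : Comod C} (f : M ⟶ N) : WeakEquivalence (S.map f) ↔ WeakEquivalence f :=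
      ((weakEquivalence_lowerStar_map_iff hind (universalBraiding C dual) f).trans
        (weakEquivalence_lowerStar_map_iff hind P f).symm).trans
        ⟨hT.weakEquivalence_of_map hpres f, hpres f⟩
    have hcounit (Q : Comod K ⥤ Comod C) (adj : S ⊣ Q) (N : Comod K) :
        WeakEquivalence (adj.counit.app N) :=
      ((hind B K).weakEquivalence_iff _).2
        (hw _ (weakEquivalence_counit_universalBraiding dual hC hP adj N))
    refine ⟨.of_weakEquivalence_counit (isLeftQuillen_lowerStar hind _ dual hX) hS
      fun N _ => hcounit _ _ N, weakEquivalence_restrictRight_canonicalMap hind P dual hB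
        (hT.weakEquivalence_counit hpres), ?_⟩
    intro N hN
    let adj₁ := (universalBraiding C dual).starAdjunction k dual
    let adj₂ := changeOfCoringsAdjunction k (canonicalMap P dual)
    have h₁ : WeakEquivalence ((changeOfCorings k (canonicalMap P dual)).map
        (adj₁.counit.app ((corestriction k (canonicalMap P dual)).obj N))) :=
      (weakEquivalence_changeOfCorings_map_iff hind _ _).2 (hcounit _ _ _)
    -- The composite adjunction inherits the Quillen equivalence from `T_* ⊣ T^*`. Its counit at `N`
    -- is the map in `h₁` followed by the counit of the change of corings, which is therefore a weak
    -- equivalence.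
    have h₂ : WeakEquivalence ((adj₁.comp adj₂).counit.app N) :=
      (hT.of_iso (lowerStarIso k P dual).symm).weakEquivalence_counit
        (fun f hf => (weakEquivalence_changeOfCorings_map_iff hind _ _).2 ((hS f).2 hf)) N hN
    rw [Adjunction.comp_counit_app] at h₂
    exact weakEquivalence_of_precomp _ _ (hf := h₁) (hfg := h₂)
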